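/- Let $k\ge 2$ be an integer and let $r>-1$ be a real number. Write $[n_1,\dots,n_k]$ for the least common multiple of positive integers $n_1,\dots,n_k$. Let $(\mathcal G_j(p))$, for $p$ prime and $1\le j\le k$, be independent random variables with $\mathbb P(\mathcal G_j(p)=m)=\left(1-\frac1p\right)p^{-m}$ for $m\ge 0$, and put $$R_k=\prod_{p}p^{\max_{j\le k}\mathcal G_j(p)-\sum_{j\le k}\mathcal G_j(p)},\qquad p_k(n)=\mathbb P\left(R_k=\tfrac1n\right)\quad(n\ge1).$$ Let $$C_{r,k}=\prod_p\left(1-\frac1p\right)^k\sum_{\nu_1,\dots,\nu_k\ge0}\frac{p^{\,r\max_j\nu_j}}{p^{(r+1)(\nu_1+\cdots+\nu_k)}}.$$ Then the Dirichlet series $\sum_{n\ge1}n^{-r}p_k(n)$ converges and $$C_{r,k}=\sum_{n=1}^{\infty}n^{-r}p_k(n).$$ Moreover, for every integer $x\ge2$, if $X_1,\dots,X_k$ are independent and uniformly distributed on $\{1,\dots,x\}$, then $$\mathbb E\left(\frac{[X_1,\dots,X_k]^r}{x^{kr}}\right)=\frac1{x^k}\sum_{1\le n_1,\dots,n_k\le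 x}\left(\frac{[n_1,\dots,n_k]}{x^k}\right)^r=\frac{C_{r,k}}{(r+1)^k}+E_{r,k}(x)$$ and $$\mathbb E\left(\frac{[X_1,\dots,X_k]^r}{(X_1\cdots X_k)^r}\right)=\frac1{x^k}\sum_{1\le n_1,\dots,n_k\le x}\left(\frac{[n_1,\dots,n_k]}{n_1\cdots n_k}\right)^r=C_{r,k}+E^*_{r,k}(x),$$ where, uniformly for integers $x\ge2$, both $E_{r,k}(x)$ and $E^*_{r,k}(x)$ are $$\begin{cases}O_{r,k}\left(x^{-\frac{r+1}2}(\log x)^{\max(2^k-k-1,\;2k^2-k-2)}\right)&\text{if }-1<r\le1,\\[2pt] O_{r,k}\left(x^{-1}(\log x)^{k-1}\right)&\text{if }r>1.\end{cases}$$ -/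

import Mathlib

open MeasureTheory ProbabilityTheory

/-- The tuples `(n₁, …, n_k)` of integers with `1 ≤ n_i ≤ x`. -/
def boxTuples (k x : ℕ) : Finset (Fin k → ℕ) :=
  Fintype.piFinset fun _ => Finset.Icc 1 x

/-- The least common multiple `[n₁, …, n_k]`. -/
def tupleLcm {k : ℕ} (n : Fin k → ℕ) : ℕ :=
  Finset.univ.lcm n

/-- The joint law of `k` independent random variables that are uniform on `{1, …, x}`. -/
noncomputable def uniformTupleLaw (k x : ℕ) : Measure (Fin k → ℕ) :=
  Measure.pi fun _ => uniformOn (Set.Icc 1 x)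

/-- The law on `ℕ` that gives `m` the mass `(1 - 1/p) * (1/p) ^ m`, for a prime `p`
(Mathlib's geometric law with success probability `1 - 1/p`). -/
noncomputable def geomLaw (p : Nat.Primes) : Measure ℕ :=
  geometricMeasure ⟨1 - 1 / ((p : ℕ) : ℝ), by
    have h : (1 : ℝ) ≤ ((p : ℕ) : ℝ) := by exact_mod_cast p.2.one_lt.le
    have h' : 1 / ((p : ℕ) : ℝ) ≤ 1 := by
      rw [div_le_one (by linarith)]
      exact h
    have h'' : 0 ≤ 1 / ((p : ℕ) : ℝ) := by positivity
    constructor <;> linarith⟩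

/-- The joint law of independent random variables `G_j(p)`, for `p` prime and `j ≤ k`, with
`G_j(p)` distributed as `geomLaw p`; a sample point `ω` has `ω p j = G_j(p)`. -/
noncomputable def geomFamilyLaw (k : ℕ) : Measure (Nat.Primes → Fin k → ℕ) :=
  Measure.infinitePi fun p => Measure.pi fun _ => geomLaw p

/-- The random variable `R_k = ∏_p p ^ (max_j G_j(p) - ∑_j G_j(p))`. For `k ≥ 1` all factors lie
in `(0, 1]`, so the product converges at every sample point (possibly to `0`). -/
noncomputable def lcmRatioVar (k : ℕ) (ω : Nat.Primes → Fin k → ℕ) : ℝ :=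
  ∏' p : Nat.Primes, ((p : ℕ) : ℝ) ^ (((Finset.univ.sup (ω p) : ℕ) : ℤ) - ((∑ j, ω p j : ℕ) : ℤ))

/-- `p_k(n)`, the probability that `R_k = 1/n`. -/
noncomputable def lcmRatioProb (k n : ℕ) : ℝ :=
  (geomFamilyLaw k).real {ω | lcmRatioVar k ω = 1 / (n : ℝ)}

/-- The constant
`C_{r,k} = ∏_p (1 - 1/p)^k ∑_{ν₁, …, ν_k ≥ 0} p^(r max ν_j) / p^((r+1)(ν₁ + ⋯ + ν_k))`. -/
noncomputable def lcmMomentConst (r : ℝ) (k : ℕ) : ℝ :=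
  ∏' p : Nat.Primes, (1 - 1 / ((p : ℕ) : ℝ)) ^ k *
    ∑' ν : Fin k → ℕ, ((p : ℕ) : ℝ) ^ (r * ((Finset.univ.sup ν : ℕ) : ℝ)) /
      ((p : ℕ) : ℝ) ^ ((r + 1) * ((∑ j, ν j : ℕ) : ℝ))

/-- The order of magnitude of the error terms. For `k ≥ 2` the subtractions in the exponents
do not truncate. -/
noncomputable def lcmMomentError (r : ℝ) (k x : ℕ) : ℝ :=
  if r ≤ 1 then
    (x : ℝ) ^ (-((r + 1) / 2)) * Real.log x ^ max (2 ^ k - k - 1) (2 * k ^ 2 - k - 2)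
  else
    (x : ℝ) ^ (-1 : ℝ) * Real.log x ^ (k - 1)

/-! ### Euler products over finitely supported functions -/

section FinsuppProd

variable {ι A : Type*} [Zero A]

/-! Asymptotics. The function `([n₁, …, n_k] / (n₁ ⋯ n_k)) ^ r` is multiplicative in the tuple: at
each prime it equals `(p ^ (-r)) ^ e`, where `e` (`excess`) is the sum minus the maximum of the
exponents. Hence it is a divisor sum of `g(d₁, …, d_k)` over `d_i ∣ n_i`, where `g` is
multiplicative and its local factors `lcmCoeff` are mixed differences (`hasSum_lcmCoeff_dvd`).
Weight the box sum by `∏ (n_i / x) ^ t`; `t = r` yields the first average and `t = 0` the second.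
Interchanging sums leaves one-variable sums over the multiples of `d_i`, each equal to `x / ((t + 1)
d_i)` up to a relative error `O((d_i / x) ^ θ)`, even when `d_i > x`. So the main term is `∑ g(d) /
∏ d_i`, whose Euler product is `C_{r,k}` (`tsum_lcmCoeff_div`), and the error is at most a constant
times `x ^ (-θ) ∑ |g(d)| d_i ^ θ / ∏ d_j` (`abs_boxSum_sub_le`).

The last sum is small because `lcmCoeff` vanishes at `a ≠ 0` unless the maximum of `a` is attained
twice (`exists_ne_eq_sup_of_mixedDiff_ne_zero`). For `r ≤ 0` it converges with `θ = (r + 1) / 2`.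
For `r ≥ 0` take `θ = 1 - η`: only the exponent vectors with two ones, one of them at `i`,
contribute as much as `p ^ (-(1 + η))`. There are `k - 1` of these, so the sum is `O((1 + 1/η) ^ (k
- 1))`, and `η = 1 / (2 log x)` gives `x⁻¹ (log x) ^ (k - 1)`. For `-1 < r ≤ 1` this is at least as
strong as the stated error.

Dirichlet series. `R_k = 1/n` means that at every prime the excess of the geometric variables is the
exponent of `p` in `n`. By independence `p_k(n)` is a product over primes, so `∑ n ^ (-r) p_k(n)`
has an Euler product whose factors are the expectations of `p ^ (-r e)`, that is, the factors of
`C_{r,k}`. -/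

theorem sum_finsupp_prod_le {u : ι → A → ℝ} (hu : ∀ i a, 0 ≤ u i a) {T : ℝ}
    (hT : ∀ s : Finset (ι × A), (∀ x ∈ s, x.2 ≠ 0) → ∑ x ∈ s, u x.1 x.2 ≤ T)
    (F : Finset (ι →₀ A)) : ∑ d ∈ F, d.prod u ≤ Real.exp T := by
  classical
  have hprod : ∀ d : ι →₀ A, d.prod u = ∏ x ∈ d.graph, u x.1 x.2 := by
    intro d
    simp [Finsupp.graph, Finsupp.prod]
    rfl
  -- A finitely supported function is determined by its graph, a finite set of pairs. So the sum is
  -- part of the expansion of `∏ (1 + u)` over the union of the graphs.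
  set U : Finset (ι × A) := F.biUnion Finsupp.graph with hU
  calc ∑ d ∈ F, d.prod u = ∑ s ∈ F.image Finsupp.graph, ∏ x ∈ s, u x.1 x.2 := by
        rw [Finset.sum_image fun _ _ _ _ h => Finsupp.graph_injective ι A h]
        exact Finset.sum_congr rfl fun d _ => hprod d
    _ ≤ ∑ s ∈ U.powerset, ∏ x ∈ s, u x.1 x.2 := by
        refine Finset.sum_le_sum_of_subset_of_nonneg ?_ fun s _ _ =>
          Finset.prod_nonneg fun x _ => hu _ _
        intro s hs
        obtain ⟨d, hd, rfl⟩ := Finset.mem_image.1 hs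
        exact Finset.mem_powerset.2 (Finset.subset_biUnion_of_mem Finsupp.graph hd)
    _ = ∏ x ∈ U, (1 + u x.1 x.2) := (Finset.prod_one_add U).symm
    _ ≤ ∏ x ∈ U, Real.exp (u x.1 x.2) :=
        Finset.prod_le_prod (fun x _ => by linarith [hu x.1 x.2])
          fun x _ => by linarith [Real.add_one_le_exp (u x.1 x.2)]
    _ = Real.exp (∑ x ∈ U, u x.1 x.2) := (Real.exp_sum _ _).symm
    _ ≤ Real.exp T := by
        refine Real.exp_le_exp.2 (hT _ ?_)
        intro x hx
        obtain ⟨d, -, hd⟩ := Finset.mem_biUnion.1 hx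
        exact (Finsupp.mem_graph_iff.1 hd).2

theorem summable_norm_finsupp_prod {w : ι → A → ℝ}
    (hs : Summable fun x : ι × {a : A // a ≠ 0} => |w x.1 x.2|) :
    Summable fun d : ι →₀ A => |d.prod w| := by
  have h : ∀ d : ι →₀ A, |d.prod w| = d.prod fun i a => |w i a| :=
    fun d => Finset.abs_prod _ _
  simp_rw [h]
  refine summable_of_sum_le (c := Real.exp (∑' x : ι × {a : A // a ≠ 0}, |w x.1 x.2|))
    (fun d => Finset.prod_nonneg fun _ _ => abs_nonneg _) fun F =>
      sum_finsupp_prod_le (fun _ _ => abs_nonneg _) (fun s hs0 => ?_) F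
  classical
  have : ∑ x ∈ s, |w x.1 x.2| =
      ∑ x ∈ s.attach.image (fun x => ((x.1.1, ⟨x.1.2, hs0 _ x.2⟩) : ι × {a : A // a ≠ 0})),
        |w x.1 x.2| := by
    rw [Finset.sum_image, ← Finset.sum_attach]
    rintro ⟨⟨a, b⟩, _⟩ _ ⟨⟨c, d⟩, _⟩ _ h
    simpa using h
  rw [this]
  exact hs.sum_le_tsum _ fun _ _ => abs_nonneg _

/-- Induction on `S`: a function supported in `insert j S` is a value at `j` together with a
function supported in `S`, and absolutely convergent series multiply. -/
theorem hasSum_finsupp_prod_supported {w : ι → A → ℝ} (hw0 : ∀ i, w i 0 = 1)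
    (hs : Summable fun x : ι × {a : A // a ≠ 0} => |w x.1 x.2|) [DecidableEq ι] (S : Finset ι) :
    HasSum (fun d : ι →₀ A => if d.support ⊆ S then d.prod w else 0)
      (∏ i ∈ S, ∑' a, w i a) := by
  have hsum : ∀ i, Summable fun a => |w i a| := by
    intro i
    have h1 : Summable fun a : {a : A // a ≠ 0} => |w i a| :=
      hs.comp_injective (i := fun a => (i, a)) fun a b h => (Prod.mk.inj h).2
    have h2 : Summable fun a : ({a : A | a ≠ 0} : Set A) => |w i a| := h1
    have h3 : Summable fun a : (({a : A | a ≠ 0}ᶜ : Set A)) => |w i a| := by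
      have : Finite (({a : A | a ≠ 0}ᶜ : Set A)) := by
        have : ({a : A | a ≠ 0}ᶜ : Set A) = {0} := by ext; simp
        rw [this]; infer_instance
      exact Summable.of_finite
    exact h2.add_compl h3
  classical
  induction S using Finset.induction_on with
  | empty =>
    have : (fun d : ι →₀ A => if d.support ⊆ ∅ then d.prod w else 0) =
        fun d => if d = 0 then 1 else 0 := by
      ext d
      by_cases hd : d = 0
      · simp [hd]
      · simp [hd]
    rw [this]
    simpa using hasSum_ite_eq (0 : ι →₀ A) (1 : ℝ)
  | insert j S hj ih =>
    rw [Finset.prod_insert hj]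
    have hsG : Summable fun d : ι →₀ A => |if d.support ⊆ S then d.prod w else 0| := by
      refine (summable_norm_finsupp_prod hs).of_nonneg_of_le (fun _ => abs_nonneg _) fun d => ?_
      split_ifs <;> simp
    have hsP : Summable fun x : A × (ι →₀ A) =>
        w j x.1 * if x.2.support ⊆ S then x.2.prod w else 0 :=
      summable_mul_of_summable_norm (f := w j)
        (g := fun d : ι →₀ A => if d.support ⊆ S then d.prod w else 0) (hsum j) hsG
    have hmul := (hsum j).of_abs.hasSum.mul ih hsP
    -- Restricting to nonzero terms is what makes the update injective: there the second component
    -- is supported in `S`, so it vanishes at `j`.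
    let φ : (Function.support fun x : A × (ι →₀ A) =>
        w j x.1 * if x.2.support ⊆ S then x.2.prod w else 0) → ι →₀ A :=
      fun x => x.1.2.update j x.1.1
    suffices h : Function.Injective φ ∧
        (Function.support fun d : ι →₀ A => if d.support ⊆ insert j S then d.prod w else 0) ⊆
          Set.range φ ∧
        ∀ x, (if (φ x).support ⊆ insert j S then (φ x).prod w else 0) =
          w j x.1.1 * if x.1.2.support ⊆ S then x.1.2.prod w else 0 from
      (hasSum_iff_hasSum_of_ne_zero_bij φ h.1 h.2.1 h.2.2).2 hmul
    refine ⟨?_, ?_, ?_⟩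
    · rintro ⟨⟨a, d⟩, hx⟩ ⟨⟨b, d'⟩, hy⟩ h
      have hd : d.support ⊆ S := by
        by_contra hc; simp [hc] at hx
      have hd' : d'.support ⊆ S := by
        by_contra hc; simp [hc] at hy
      have hdj : d j = 0 := by
        by_contra hc; exact hj (hd (Finsupp.mem_support_iff.2 hc))
      have hdj' : d' j = 0 := by
        by_contra hc; exact hj (hd' (Finsupp.mem_support_iff.2 hc))
      simp only [φ] at h
      have h1 : a = b := by simpa using DFunLike.congr_fun h j
      have h2 : d = d' := by
        ext i
        by_cases hi : i = j
        · rw [hi, hdj, hdj']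
        · simpa [Finsupp.update, Function.update, hi] using DFunLike.congr_fun h i
      simp [h1, h2]
    · intro d hd
      have hdS : d.support ⊆ insert j S := by
        by_contra hc; simp [hc] at hd
      rw [Function.mem_support, if_pos hdS] at hd
      have her : (d.erase j).support ⊆ S := by
        intro i hi
        rw [Finsupp.support_erase, Finset.mem_erase] at hi
        exact (Finset.mem_insert.1 (hdS hi.2)).resolve_left hi.1
      have hmul : w j (d j) * (d.erase j).prod w = d.prod w :=
        Finsupp.mul_prod_erase' d j w fun i => hw0 i
      refine ⟨⟨(d j, d.erase j), ?_⟩, ?_⟩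
      · rw [Function.mem_support, if_pos her]
        simpa [hmul] using hd
      · ext i
        by_cases hi : i = j
        · simp [φ, hi]
        · simp [φ, Finsupp.update, Function.update, hi]
    · rintro ⟨⟨a, d⟩, hx⟩
      have hd : d.support ⊆ S := by
        by_contra hc; simp [hc] at hx
      have hdj : d j = 0 := by
        by_contra hc; exact hj (hd (Finsupp.mem_support_iff.2 hc))
      have h1 : (d.update j a).support ⊆ insert j S := by
        intro i hi
        by_cases hij : i = j
        · simp [hij]
        · refine Finset.mem_insert_of_mem (hd ?_)
          rw [Finsupp.mem_support_iff] at hi ⊢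
          simpa [Finsupp.update, Function.update, hij] using hi
      have h2 : (d.update j a).erase j = d := by
        ext i
        by_cases hi : i = j
        · simp [hi, hdj]
        · simp [Finsupp.update, Function.update, hi]
      have hmul := Finsupp.mul_prod_erase' (d.update j a) j w fun i => hw0 i
      rw [h2] at hmul
      simp only [φ, if_pos h1, if_pos hd]
      rw [← hmul]
      simp

/-- The Euler product for sums over finitely supported functions. -/
theorem hasProd_tsum_finsupp_prod {w : ι → A → ℝ} (hw0 : ∀ i, w i 0 = 1)
    (hs : Summable fun x : ι × {a : A // a ≠ 0} => |w x.1 x.2|) :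
    HasProd (fun i => ∑' a, w i a) (∑' d : ι →₀ A, d.prod w) := by
  classical
  have h := tendsto_tsum_of_dominated_convergence (𝓕 := (Filter.atTop : Filter (Finset ι)))
    (f := fun S (d : ι →₀ A) => if d.support ⊆ S then d.prod w else 0)
    (g := fun d => d.prod w) (bound := fun d => |d.prod w|)
    (summable_norm_finsupp_prod hs)
    (fun d => tendsto_const_nhds.congr' (by
      filter_upwards [Filter.eventually_ge_atTop d.support] with S hS
      rw [if_pos hS]))
    (Filter.Eventually.of_forall fun S d => by split_ifs <;> simp)
  simp_rw [(hasSum_finsupp_prod_supported hw0 hs _).tsum_eq] at h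
  exact h

end FinsuppProd

/-! ### Mixed differences: inversion, generating function, vanishing -/

section MixedDiff

variable {k : ℕ}

/-- The indicator function of `s`, with values in `ℕ`. -/
def natIndicator (s : Finset (Fin k)) : Fin k → ℕ := fun i => if i ∈ s then 1 else 0

open Classical in
/-- The mixed backward difference of `F`, where `F` is extended by `0` to tuples with a negative
entry. -/
noncomputable def mixedDiff (F : (Fin k → ℕ) → ℝ) (a : Fin k → ℕ) : ℝ :=
  ∑ s : Finset (Fin k), if natIndicator s ≤ a then (-1) ^ s.card * F (a - natIndicator s) else 0

theorem natIndicator_le_iff {s : Finset (Fin k)} {a : Fin k → ℕ} :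
    natIndicator s ≤ a ↔ ∀ i ∈ s, 1 ≤ a i := by
  simp only [natIndicator, Pi.le_def]
  refine forall_congr' fun i => ?_
  by_cases h : i ∈ s <;> simp [h]

theorem sum_natIndicator (s : Finset (Fin k)) : ∑ i, natIndicator s i = s.card := by
  simp [natIndicator]

/-- After interchanging sums, `F b` carries the coefficient `∑ (-1) ^ |s|` over the subsets `s` of
`{i | b i < v i}`. It is zero unless that set is empty, which means `b = v`. -/
theorem sum_Iic_mixedDiff (F : (Fin k → ℕ) → ℝ) (v : Fin k → ℕ) :
    ∑ a ∈ Finset.Iic v, mixedDiff F a = F v := by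
  classical
  have h1 : ∀ s : Finset (Fin k),
      (∑ a ∈ Finset.Iic v,
        if natIndicator s ≤ a then (-1) ^ s.card * F (a - natIndicator s) else 0) =
      ∑ b ∈ Finset.Iic v, if b + natIndicator s ≤ v then (-1) ^ s.card * F b else 0 := by
    intro s
    rw [← Finset.sum_filter, ← Finset.sum_filter]
    refine Finset.sum_bij' (fun a _ => a - natIndicator s) (fun b _ => b + natIndicator s)
      ?_ ?_ ?_ ?_ ?_
    · intro a ha
      simp only [Finset.mem_filter, Finset.mem_Iic] at ha ⊢
      rw [tsub_add_cancel_of_le ha.2]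
      exact ⟨tsub_le_self.trans ha.1, ha.1⟩
    · intro b hb
      simp only [Finset.mem_filter, Finset.mem_Iic] at hb ⊢
      exact ⟨hb.2, le_add_self⟩
    · intro a ha
      simp only [Finset.mem_filter, Finset.mem_Iic] at ha
      exact tsub_add_cancel_of_le ha.2
    · intro b _
      exact add_tsub_cancel_right _ _
    · intro a _
      rfl
  have h2 : ∀ b ∈ Finset.Iic v,
      (∑ s : Finset (Fin k), if b + natIndicator s ≤ v then (-1) ^ s.card * F b else 0) =
        if b = v then F v else 0 := by
    intro b hb
    rw [Finset.mem_Iic] at hb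
    have h3 : ∀ s : Finset (Fin k), b + natIndicator s ≤ v ↔
        s ∈ (Finset.univ.filter fun i => b i < v i).powerset := by
      intro s
      rw [Finset.mem_powerset, Finset.subset_iff]
      simp only [Pi.le_def, Pi.add_apply, Finset.mem_filter, Finset.mem_univ, true_and,
        natIndicator]
      refine forall_congr' fun i => ?_
      have := hb i
      by_cases h : i ∈ s
      · simp only [h, if_true, forall_const]; omega
      · simpa [h] using this
    simp_rw [h3]
    rw [← Finset.sum_filter]
    simp only [Finset.filter_mem_eq_inter, Finset.univ_inter]
    rw [← Finset.sum_mul]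
    have h4 := Finset.sum_powerset_neg_one_pow_card (x := Finset.univ.filter fun i => b i < v i)
    have h5 : ∑ m ∈ (Finset.univ.filter fun i => b i < v i).powerset, (-1 : ℝ) ^ m.card =
        if (Finset.univ.filter fun i => b i < v i) = ∅ then 1 else 0 := by
      exact_mod_cast h4
    rw [h5]
    have h6 : (Finset.univ.filter fun i => b i < v i) = ∅ ↔ b = v := by
      rw [Finset.filter_eq_empty_iff]
      constructor
      · intro h
        ext i
        exact le_antisymm (hb i) (not_lt.1 (h (Finset.mem_univ i)))
      · rintro rfl
        simp
    by_cases h : b = v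
    · simp [h]
    · simp [h6, h]
  simp only [mixedDiff]
  rw [Finset.sum_comm]
  simp_rw [h1]
  rw [Finset.sum_comm, Finset.sum_congr rfl h2]
  simp

/-- The shift by the indicator of `s` contributes `(-q) ^ |s|`, and these add up to `(1 - q) ^ k`.
-/
theorem hasSum_mixedDiff (F : (Fin k → ℕ) → ℝ) (q : ℝ)
    (hF : Summable fun b : Fin k → ℕ => F b * q ^ ∑ i, b i) :
    HasSum (fun a => mixedDiff F a * q ^ ∑ i, a i)
      ((1 - q) ^ k * ∑' b : Fin k → ℕ, F b * q ^ ∑ i, b i) := by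
  classical
  have h : ∀ s : Finset (Fin k), HasSum (fun a : Fin k → ℕ =>
      if natIndicator s ≤ a then (-1) ^ s.card * F (a - natIndicator s) * q ^ ∑ i, a i else 0)
      ((-1) ^ s.card * q ^ s.card * ∑' b : Fin k → ℕ, F b * q ^ ∑ i, b i) := by
    intro s
    have hinj : Function.Injective fun b : Fin k → ℕ => b + natIndicator s :=
      add_left_injective _
    refine (hinj.hasSum_iff ?_).1 ?_
    · intro a ha
      refine if_neg fun hle => ha ⟨a - natIndicator s, tsub_add_cancel_of_le hle⟩
    · refine HasSum.congr_fun (hF.hasSum.mul_left ((-1) ^ s.card * q ^ s.card)) fun b => ?_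
      rw [Function.comp, if_pos le_add_self]
      simp only [add_tsub_cancel_right, Pi.add_apply,
        Finset.sum_add_distrib, sum_natIndicator, pow_add]
      ring
  convert hasSum_sum fun s (_ : s ∈ (Finset.univ : Finset (Finset (Fin k)))) => h s using 1
  · ext a
    rw [mixedDiff, Finset.sum_mul]
    refine Finset.sum_congr rfl fun s _ => ?_
    split_ifs <;> ring
  · rw [← Finset.sum_mul]
    congr 1
    have := Finset.prod_one_add (f := fun _ : Fin k => -q) Finset.univ
    simp only [Finset.prod_const, Finset.powerset_univ, Finset.card_univ, Fintype.card_fin] at this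
    rw [sub_eq_add_neg, this]
    exact Finset.sum_congr rfl fun s _ => by rw [← mul_pow, neg_one_mul]

theorem abs_mixedDiff_le {F : (Fin k → ℕ) → ℝ} {a : Fin k → ℕ} {B : ℝ} (hB : 0 ≤ B)
    (h : ∀ b ≤ a, |F b| ≤ B) : |mixedDiff F a| ≤ 2 ^ k * B := by
  classical
  refine (Finset.abs_sum_le_sum_abs _ _).trans ?_
  have : ∀ s ∈ (Finset.univ : Finset (Finset (Fin k))),
      |if natIndicator s ≤ a then (-1) ^ s.card * F (a - natIndicator s) else 0| ≤ B := by
    intro s _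
    split_ifs
    · rw [abs_mul, abs_pow, abs_neg, abs_one, one_pow, one_mul]
      exact h _ tsub_le_self
    · simpa using hB
  refine (Finset.sum_le_sum this).trans ?_
  simp

/-- The terms of `s` and `insert i s` have opposite signs and cancel in pairs. -/
theorem mixedDiff_eq_zero {F : (Fin k → ℕ) → ℝ} {a : Fin k → ℕ} {i : Fin k} (hi : 1 ≤ a i)
    (h : ∀ s : Finset (Fin k), i ∉ s → natIndicator s ≤ a →
      F (a - natIndicator (insert i s)) = F (a - natIndicator s)) : mixedDiff F a = 0 := by
  classical
  have h1 := Finset.sum_powerset_insert (Finset.notMem_erase i Finset.univ) fun s =>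
    if natIndicator s ≤ a then (-1) ^ s.card * F (a - natIndicator s) else 0
  rw [Finset.insert_erase (Finset.mem_univ i), Finset.powerset_univ] at h1
  rw [mixedDiff, h1, ← Finset.sum_add_distrib]
  refine Finset.sum_eq_zero fun s hs => ?_
  have his : i ∉ s := fun hc => by
    simpa using Finset.mem_powerset.1 hs hc
  by_cases hle : natIndicator s ≤ a
  · have hle' : natIndicator (insert i s) ≤ a := by
      rw [natIndicator_le_iff] at hle ⊢
      intro j hj
      rcases Finset.mem_insert.1 hj with rfl | hj
      · exact hi
      · exact hle j hj
    rw [if_pos hle, if_pos hle', h s his hle, Finset.card_insert_of_notMem his]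
    ring
  · have hle' : ¬ natIndicator (insert i s) ≤ a := by
      rw [natIndicator_le_iff] at hle ⊢
      exact fun hc => hle fun j hj => hc j (Finset.mem_insert_of_mem hj)
    rw [if_neg hle, if_neg hle', add_zero]

theorem mixedDiff_zero (F : (Fin k → ℕ) → ℝ) : mixedDiff F 0 = F 0 := by
  have := sum_Iic_mixedDiff F 0
  rwa [show Finset.Iic (0 : Fin k → ℕ) = {0} from by ext; simp [← bot_eq_zero],
    Finset.sum_singleton] at this

theorem mixedDiff_natIndicator_pair (F : (Fin k → ℕ) → ℝ) {i j : Fin k} (hij : i ≠ j) :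
    mixedDiff F (natIndicator {i, j}) =
      F (natIndicator {i, j}) - F (natIndicator {i}) - F (natIndicator {j}) + F 0 := by
  classical
  have h : ∀ s : Finset (Fin k), natIndicator s ≤ natIndicator {i, j} ↔
      s ∈ ({i, j} : Finset (Fin k)).powerset := by
    intro s
    rw [natIndicator_le_iff, Finset.mem_powerset, Finset.subset_iff]
    refine forall₂_congr fun l _ => ?_
    simp only [natIndicator]
    split_ifs with h <;> simp [h]
  simp only [mixedDiff, h]
  rw [← Finset.sum_filter]
  simp only [Finset.filter_mem_eq_inter, Finset.univ_inter]
  have e1 : natIndicator {i, j} - natIndicator {i} = natIndicator {j} := by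
    ext l
    by_cases h1 : l = i
    · subst h1; simp [natIndicator, hij]
    · by_cases h2 : l = j <;> simp [natIndicator, h1, h2, hij.symm]
  have e2 : natIndicator {i, j} - natIndicator {j} = natIndicator {i} := by
    ext l
    by_cases h1 : l = j
    · subst h1; simp [natIndicator, hij.symm]
    · by_cases h2 : l = i <;> simp [natIndicator, h1, h2, hij]
  have e3 : natIndicator (∅ : Finset (Fin k)) = 0 := by ext; simp [natIndicator]
  have e4 : ({j} : Finset (Fin k)).powerset = {∅, {j}} := by
    ext s
    simp [Finset.subset_singleton_iff]
  have e5 : (∅ : Finset (Fin k)) ∉ ({{j}} : Finset (Finset (Fin k))) := by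
    rw [Finset.mem_singleton]
    exact (Finset.singleton_ne_empty j).symm
  rw [Finset.sum_powerset_insert (by simpa using hij), e4, Finset.sum_insert e5,
    Finset.sum_singleton, Finset.sum_insert e5, Finset.sum_singleton, insert_empty_eq,
    Finset.card_pair hij, tsub_self, e1, e2, e3, tsub_zero]
  simp
  ring

end MixedDiff

/-! ### Sum minus maximum of an exponent vector -/

section Excess

variable {k : ℕ}

/-- The difference between the sum and the maximum of the entries. -/
def excess (a : Fin k → ℕ) : ℕ := ∑ i, a i - Finset.univ.sup a

theorem sup_le_sum (a : Fin k → ℕ) : Finset.univ.sup a ≤ ∑ i, a i :=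
  Finset.sup_le fun _ hi => Finset.single_le_sum (fun _ _ => Nat.zero_le _) hi

theorem excess_add_sup (a : Fin k → ℕ) : excess a + Finset.univ.sup a = ∑ i, a i :=
  Nat.sub_add_cancel (sup_le_sum a)

theorem excess_zero : excess (0 : Fin k → ℕ) = 0 := by simp [excess]

/-- The maximum grows by at most the largest single increment, while the sum grows by all of them.
-/
theorem excess_mono {a b : Fin k → ℕ} (h : a ≤ b) : excess a ≤ excess b := by
  have h1 : Finset.univ.sup b ≤ Finset.univ.sup a + ∑ i, (b i - a i) := by
    refine Finset.sup_le fun i hi => ?_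
    have h2 : a i ≤ Finset.univ.sup a := Finset.le_sup hi
    have h3 : b i - a i ≤ ∑ i, (b i - a i) :=
      Finset.single_le_sum (f := fun i => b i - a i) (fun _ _ => Nat.zero_le _) hi
    omega
  have h2 : ∑ i, b i = ∑ i, a i + ∑ i, (b i - a i) := by
    rw [← Finset.sum_add_distrib]
    exact Finset.sum_congr rfl fun i _ => by have : a i ≤ b i := h i; omega
  have := excess_add_sup a
  have := excess_add_sup b
  omega

theorem excess_eq_sum_erase {a : Fin k → ℕ} {i : Fin k} (h : ∀ j, a j ≤ a i) :
    excess a = ∑ j ∈ Finset.univ.erase i, a j := by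
  have h1 : Finset.univ.sup a = a i :=
    le_antisymm (Finset.sup_le fun j _ => h j) (Finset.le_sup (Finset.mem_univ i))
  have h2 := Finset.add_sum_erase Finset.univ a (Finset.mem_univ i)
  rw [excess, h1]
  omega

theorem excess_natIndicator_singleton (i : Fin k) : excess (natIndicator {i}) = 0 := by
  rw [excess_eq_sum_erase (i := i)]
  · refine Finset.sum_eq_zero fun j hj => ?_
    simp [natIndicator, Finset.ne_of_mem_erase hj]
  · intro j
    simp only [natIndicator]
    split_ifs <;> simp_all

theorem excess_natIndicator_pair {i j : Fin k} (hij : i ≠ j) :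
    excess (natIndicator {i, j}) = 1 := by
  have h1 : Finset.univ.sup (natIndicator {i, j}) = 1 := by
    refine le_antisymm (Finset.sup_le fun l _ => ?_) ?_
    · simp only [natIndicator]; split_ifs <;> simp
    · have := Finset.le_sup (f := natIndicator {i, j}) (Finset.mem_univ i)
      simpa [natIndicator] using this
  rw [excess, sum_natIndicator, Finset.card_pair hij, h1]

/-- The mixed difference of a function of the excess vanishes unless the maximum is attained at
least twice. -/
theorem exists_ne_eq_sup_of_mixedDiff_ne_zero {G : ℕ → ℝ} {a : Fin k → ℕ} (ha : a ≠ 0)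
    (h : mixedDiff (fun b => G (excess b)) a ≠ 0) (i : Fin k) :
    ∃ j, j ≠ i ∧ a j = Finset.univ.sup a := by
  by_contra! hc
  have hpos : 0 < Finset.univ.sup a := by
    by_contra h0
    refine ha (funext fun j => ?_)
    have : a j ≤ Finset.univ.sup a := Finset.le_sup (Finset.mem_univ j)
    simp only [Pi.zero_apply]
    omega
  have hlt : ∀ j, j ≠ i → a j < Finset.univ.sup a := fun j hj =>
    lt_of_le_of_ne (Finset.le_sup (Finset.mem_univ j)) (hc j hj)
  have hi : a i = Finset.univ.sup a := by
    obtain ⟨j, -, hj⟩ := Finset.exists_mem_eq_sup Finset.univ ⟨i, Finset.mem_univ i⟩ a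
    by_cases hji : j = i
    · rw [← hji, hj]
    · exact absurd hj.symm (hc j hji)
  -- Here `i` is the only position of the maximum. Lowering `a i` by one keeps it maximal, so the
  -- excess stays the sum of the other entries and does not depend on whether `i` is shifted.
  refine h (mixedDiff_eq_zero (i := i) (by omega) fun s hs _ => ?_)
  have h1 : excess (a - natIndicator (insert i s)) =
      ∑ j ∈ Finset.univ.erase i, (a - natIndicator (insert i s)) j := by
    refine excess_eq_sum_erase fun j => ?_
    by_cases hj : j = i
    · rw [hj]
    · have := hlt j hj
      simp only [Pi.sub_apply, natIndicator, Finset.mem_insert_self, if_true]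
      omega
  have h2 : excess (a - natIndicator s) =
      ∑ j ∈ Finset.univ.erase i, (a - natIndicator s) j := by
    refine excess_eq_sum_erase fun j => ?_
    by_cases hj : j = i
    · rw [hj]
    · have := hlt j hj
      simp only [Pi.sub_apply, natIndicator, hs, if_false]
      omega
  rw [h1, h2]
  congr 1
  refine Finset.sum_congr rfl fun j hj => ?_
  simp [natIndicator, Finset.ne_of_mem_erase hj]

end Excess

/-! ### The ratio of lcm to product as a multiplicative divisor sum -/

section Expansion

variable {k : ℕ}

theorem factorization_tupleLcm {n : Fin k → ℕ} (hn : ∀ i, n i ≠ 0) (p : ℕ) :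
    (tupleLcm n).factorization p = Finset.univ.sup fun i => (n i).factorization p := by
  classical
  suffices h : ∀ s : Finset (Fin k),
      s.lcm n ≠ 0 ∧ (s.lcm n).factorization p = s.sup fun i => (n i).factorization p from
    (h Finset.univ).2
  intro s
  induction s using Finset.induction_on with
  | empty => simp
  | insert i s _ ih =>
    rw [Finset.lcm_insert, Finset.sup_insert, ← ih.2]
    refine ⟨lcm_ne_zero_iff.2 ⟨hn i, ih.1⟩, ?_⟩
    change (Nat.lcm (n i) (s.lcm n)).factorization p = _
    rw [Nat.factorization_lcm (hn i) ih.1]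
    rfl

theorem tupleLcm_ne_zero {n : Fin k → ℕ} (hn : ∀ i, n i ≠ 0) : tupleLcm n ≠ 0 := by
  rw [tupleLcm, Ne, Finset.lcm_eq_zero_iff]
  rintro ⟨i, -, h⟩
  exact hn i h

theorem cast_eq_prod_primes {m : ℕ} (hm : m ≠ 0) {S : Finset Nat.Primes}
    (hS : ∀ p : Nat.Primes, p ∉ S → m.factorization p = 0) :
    (m : ℝ) = ∏ p ∈ S, ((p : ℕ) : ℝ) ^ m.factorization p := by
  have h1 := Nat.prod_factorization_pow_eq_self hm
  rw [Finsupp.prod_of_support_subset (s := S.map ⟨fun p : Nat.Primes => (p : ℕ),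
    fun a b h => Subtype.ext h⟩) _ _ _ (by simp), Finset.prod_map] at h1
  · conv_lhs => rw [← h1]
    push_cast
    rfl
  · intro q hq
    have hqp : q.Prime := Nat.prime_of_mem_primeFactors (by simpa using hq)
    rw [Finset.mem_map]
    refine ⟨⟨q, hqp⟩, ?_, rfl⟩
    by_contra hc
    exact (Finsupp.mem_support_iff.1 hq) (hS ⟨q, hqp⟩ hc)

theorem lcm_ratio_rpow_eq (r : ℝ) {n : Fin k → ℕ} (hn : ∀ i, n i ≠ 0) {S : Finset Nat.Primes}
    (hS : ∀ p : Nat.Primes, p ∉ S → ∀ i, (n i).factorization p = 0) :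
    ((tupleLcm n : ℝ) / ∏ i, (n i : ℝ)) ^ r =
      ∏ p ∈ S, (((p : ℕ) : ℝ) ^ (-r)) ^ excess fun i => (n i).factorization p := by
  have h1 : (tupleLcm n : ℝ) = ∏ p ∈ S, ((p : ℕ) : ℝ) ^ Finset.univ.sup fun i =>
      (n i).factorization p := by
    rw [cast_eq_prod_primes (tupleLcm_ne_zero hn) (S := S)]
    · exact Finset.prod_congr rfl fun p _ => by rw [factorization_tupleLcm hn]
    · intro p hp
      rw [factorization_tupleLcm hn]
      simp [hS p hp]
  have h2 : ∏ i, (n i : ℝ) = ∏ p ∈ S, ((p : ℕ) : ℝ) ^ ∑ i, (n i).factorization p := by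
    rw [Finset.prod_congr rfl fun i _ => cast_eq_prod_primes (hn i) fun p hp => hS p hp i,
      Finset.prod_comm]
    exact Finset.prod_congr rfl fun p _ => Finset.prod_pow_eq_pow_sum _ _ _
  rw [h1, h2, ← Finset.prod_div_distrib, ← Real.finsetProd_rpow _ _ fun p _ => by positivity]
  refine Finset.prod_congr rfl fun p _ => ?_
  have hp : (0 : ℝ) < (p : ℕ) := by exact_mod_cast p.2.pos
  rw [← excess_add_sup, pow_add, ← div_div, div_right_comm, div_self (by positivity),
    one_div, Real.rpow_neg hp.le, Real.inv_rpow (by positivity), inv_pow,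
    ← Real.rpow_natCast, ← Real.rpow_mul hp.le, ← Real.rpow_mul_natCast hp.le, mul_comm]

/-- The tuple of integers whose exponents are given by `d`. -/
def tupleOf (d : Nat.Primes →₀ (Fin k → ℕ)) (i : Fin k) : ℕ :=
  d.prod fun p a => (p : ℕ) ^ a i

theorem tupleOf_pos (d : Nat.Primes →₀ (Fin k → ℕ)) (i : Fin k) : 0 < tupleOf d i :=
  Finset.prod_pos fun p _ => pow_pos p.2.pos _

theorem tupleOf_dvd_iff {d : Nat.Primes →₀ (Fin k → ℕ)} {i : Fin k} {m : ℕ} (hm : m ≠ 0) :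
    tupleOf d i ∣ m ↔ ∀ p ∈ d.support, d p i ≤ m.factorization p := by
  constructor
  · intro h p hp
    rw [← p.2.pow_dvd_iff_le_factorization hm]
    exact (Finset.dvd_prod_of_mem (fun p : Nat.Primes => (p : ℕ) ^ d p i) hp).trans h
  · intro h
    refine Finset.prod_dvd_of_isRelPrime ?_ fun p hp =>
      (p.2.pow_dvd_iff_le_factorization hm).2 (h p hp)
    intro p _ q _ hpq
    rw [Function.onFun, ← Nat.coprime_iff_isRelPrime]
    exact Nat.Coprime.pow _ _ ((Nat.coprime_primes p.2 q.2).2 fun h => hpq (Subtype.ext h))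

/-- The local factor, at the prime `p`, of the function `g` with
`([n₁, …, n_k] / (n₁ ⋯ n_k)) ^ r = ∑ g(d₁, …, d_k)`, the sum over `d_i ∣ n_i`. -/
noncomputable def lcmCoeff (k : ℕ) (r : ℝ) (p : Nat.Primes) (a : Fin k → ℕ) : ℝ :=
  mixedDiff (fun b => (((p : ℕ) : ℝ) ^ (-r)) ^ excess b) a

theorem lcmCoeff_zero (r : ℝ) (p : Nat.Primes) : lcmCoeff k r p 0 = 1 := by
  rw [lcmCoeff, mixedDiff_zero, excess_zero, pow_zero]

-- Divisibility of every `n i` by `tupleOf d i` says that `d p` lies below the exponent vector of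
-- `n` at every prime. The sum is therefore an Euler product, and its local sums over boxes are
-- evaluated by `sum_Iic_mixedDiff`.
open Classical in
theorem hasSum_lcmCoeff_dvd (r : ℝ) {n : Fin k → ℕ} (hn : ∀ i, n i ≠ 0) :
    HasSum (fun d : Nat.Primes →₀ (Fin k → ℕ) =>
      if ∀ i, tupleOf d i ∣ n i then d.prod (lcmCoeff k r) else 0)
      (((tupleLcm n : ℝ) / ∏ i, (n i : ℝ)) ^ r) := by
  set v : Nat.Primes → Fin k → ℕ := fun p i => (n i).factorization p with hv
  set w : Nat.Primes → (Fin k → ℕ) → ℝ := fun p a => if a ≤ v p then lcmCoeff k r p a else 0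
    with hw
  have hw0 : ∀ p, w p 0 = 1 := fun p => by
    rw [hw]
    simp only [zero_le, if_true, lcmCoeff_zero]
  obtain ⟨S, hS⟩ : ∃ S : Finset Nat.Primes, ∀ p, p ∉ S → v p = 0 := by
    have hfin : (Set.Finite {p : Nat.Primes | (p : ℕ) ∣ ∏ i, n i}) := by
      refine Set.Finite.of_finite_image (f := fun p : Nat.Primes => (p : ℕ))
        ((Set.finite_Iic (∏ i, n i)).subset ?_) (fun a _ b _ h => Subtype.ext h)
      rintro _ ⟨p, hp, rfl⟩
      exact Nat.le_of_dvd (Finset.prod_pos fun i _ => Nat.pos_of_ne_zero (hn i)) hp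
    refine ⟨hfin.toFinset, fun p hp => funext fun i => ?_⟩
    rw [Set.Finite.mem_toFinset] at hp
    exact Nat.factorization_eq_zero_of_not_dvd fun h =>
      hp (h.trans (Finset.dvd_prod_of_mem n (Finset.mem_univ i)))
  have hs : Summable fun x : Nat.Primes × {a : Fin k → ℕ // a ≠ 0} => |w x.1 x.2| := by
    have hfin : Set.Finite {x : Nat.Primes × {a : Fin k → ℕ // a ≠ 0} | x.2.1 ≤ v x.1} := by
      refine Set.Finite.of_finite_image (f := fun x => (x.1, x.2.1))
        ((S ×ˢ S.biUnion fun p => Finset.Iic (v p)).finite_toSet.subset ?_) ?_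
      · rintro _ ⟨⟨p, a, ha⟩, hx, rfl⟩
        have hx : a ≤ v p := hx
        have hpS : p ∈ S := by
          by_contra hc
          rw [hS p hc] at hx
          exact ha (le_antisymm hx zero_le)
        simp only [Finset.coe_product, Set.mem_prod, Finset.mem_coe, Finset.mem_biUnion,
          Finset.mem_Iic]
        exact ⟨hpS, p, hpS, hx⟩
      · rintro ⟨p, a, ha⟩ _ ⟨q, b, hb⟩ _ h
        simpa using h
    refine summable_of_hasFiniteSupport (hfin.subset fun x hx => ?_)
    by_contra hc
    have hc : ¬ x.2.1 ≤ v x.1 := hc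
    simp [hw, hc] at hx
  have h1 := hasProd_tsum_finsupp_prod hw0 hs
  have h2 : ∀ p, ∑' a, w p a = (((p : ℕ) : ℝ) ^ (-r)) ^ excess (v p) := by
    intro p
    rw [tsum_eq_sum (s := Finset.Iic (v p))]
    · rw [← sum_Iic_mixedDiff (fun b => (((p : ℕ) : ℝ) ^ (-r)) ^ excess b) (v p)]
      refine Finset.sum_congr rfl fun a ha => ?_
      rw [hw]
      simp only [Finset.mem_Iic.1 ha, if_true]
      rfl
    · intro a ha
      rw [Finset.mem_Iic] at ha
      simp [hw, ha]
  simp_rw [h2] at h1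
  have h3 : HasProd (fun p : Nat.Primes => (((p : ℕ) : ℝ) ^ (-r)) ^ excess (v p))
      (∏ p ∈ S, (((p : ℕ) : ℝ) ^ (-r)) ^ excess (v p)) :=
    hasProd_prod_of_ne_finset_one fun p hp => by rw [hS p hp, excess_zero, pow_zero]
  have h4 := h1.unique h3
  rw [← lcm_ratio_rpow_eq r hn fun p hp i => congrFun (hS p hp) i] at h4
  rw [← h4]
  refine (summable_norm_finsupp_prod hs).of_abs.hasSum.congr_fun fun d => ?_
  have h5 : (∀ i, tupleOf d i ∣ n i) ↔ ∀ p ∈ d.support, d p ≤ v p := by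
    simp only [tupleOf_dvd_iff (hn _), Pi.le_def, hv]
    exact ⟨fun h p hp i => h i p hp, fun h i p hp => h p hp i⟩
  simp only [h5, Finsupp.prod, hw, Finset.prod_ite_zero]

end Expansion

/-! ### Power sums over multiples -/

section PowerSums

theorem exists_rpow_sub_rpow_eq {s a b : ℝ} (hs : 0 < s) (ha : 0 ≤ a) (hab : a < b) :
    ∃ c ∈ Set.Ioo a b, b ^ s - a ^ s = s * c ^ (s - 1) * (b - a) := by
  obtain ⟨c, hc, h⟩ := exists_hasDerivAt_eq_slope (fun y : ℝ => y ^ s)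
    (fun y => s * y ^ (s - 1)) hab (Real.continuous_rpow_const hs.le).continuousOn
    fun y hy => Real.hasDerivAt_rpow_const (Or.inl (ha.trans_lt hy.1).ne')
  refine ⟨c, hc, ?_⟩
  rw [h, div_mul_cancel₀ _ (sub_ne_zero.2 hab.ne')]

theorem rpow_add_one_sub_rpow_of_nonneg {t a b : ℝ} (ht : 0 ≤ t) (ha : 0 ≤ a) (hab : a ≤ b) :
    (t + 1) * a ^ t * (b - a) ≤ b ^ (t + 1) - a ^ (t + 1) ∧
      b ^ (t + 1) - a ^ (t + 1) ≤ (t + 1) * b ^ t * (b - a) := by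
  rcases hab.eq_or_lt with rfl | hab
  · simp
  obtain ⟨c, hc, h⟩ := exists_rpow_sub_rpow_eq (s := t + 1) (by linarith) ha hab
  rw [h, add_sub_cancel_right]
  have hba : 0 ≤ b - a := by linarith
  have h1 : a ^ t ≤ c ^ t := Real.rpow_le_rpow ha hc.1.le ht
  have h2 : c ^ t ≤ b ^ t := Real.rpow_le_rpow (ha.trans hc.1.le) hc.2.le ht
  constructor <;> gcongr

theorem rpow_add_one_sub_rpow_of_nonpos {t a b : ℝ} (ht : t ≤ 0) (ht' : -1 < t) (ha : 0 ≤ a)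
    (hab : a ≤ b) :
    (t + 1) * b ^ t * (b - a) ≤ b ^ (t + 1) - a ^ (t + 1) ∧
      (0 < a → b ^ (t + 1) - a ^ (t + 1) ≤ (t + 1) * a ^ t * (b - a)) := by
  rcases hab.eq_or_lt with rfl | hab
  · simp
  obtain ⟨c, hc, h⟩ := exists_rpow_sub_rpow_eq (s := t + 1) (by linarith) ha hab
  rw [h, add_sub_cancel_right]
  have hba : 0 ≤ b - a := by linarith
  have hs : 0 ≤ t + 1 := by linarith
  have h2 : b ^ t ≤ c ^ t := Real.rpow_le_rpow_of_nonpos (ha.trans_lt hc.1) hc.2.le ht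
  refine ⟨by gcongr, fun ha' => ?_⟩
  have h1 : c ^ t ≤ a ^ t := Real.rpow_le_rpow_of_nonpos ha' hc.1.le ht
  gcongr

theorem sum_rpow_of_nonneg {t : ℝ} (ht : 0 ≤ t) (N : ℕ) :
    (N : ℝ) ^ (t + 1) ≤ (t + 1) * ∑ j ∈ Finset.Icc 1 N, (j : ℝ) ^ t ∧
      (t + 1) * ∑ j ∈ Finset.Icc 1 N, (j : ℝ) ^ t ≤
        (N : ℝ) ^ (t + 1) + (t + 1) * (N : ℝ) ^ t := by
  induction N with
  | zero =>
    have h0 : (0 : ℝ) ^ (t + 1) = 0 := Real.zero_rpow (by linarith)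
    have h1 : 0 ≤ (0 : ℝ) ^ t := by positivity
    simp only [Nat.cast_zero, h0]
    constructor
    · simp
    · simp; positivity
  | succ N ih =>
    rw [Finset.sum_Icc_succ_top (by omega), mul_add]
    have h := rpow_add_one_sub_rpow_of_nonneg ht (Nat.cast_nonneg N : (0 : ℝ) ≤ N)
      (by linarith : (N : ℝ) ≤ N + 1)
    push_cast
    simp only [add_sub_cancel_left, mul_one] at h
    constructor <;> linarith [h.1, h.2, ih.1, ih.2]

/-- Comparison with the integral of `y ^ t`. Since `y ^ t` may blow up at `0`, the lower bound
compares with `[1, N + 1]` instead of `[0, N]`. -/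
theorem sum_rpow_of_nonpos {t : ℝ} (ht : t ≤ 0) (ht' : -1 < t) (N : ℕ) :
    ((N : ℝ) + 1) ^ (t + 1) - 1 ≤ (t + 1) * ∑ j ∈ Finset.Icc 1 N, (j : ℝ) ^ t ∧
      (t + 1) * ∑ j ∈ Finset.Icc 1 N, (j : ℝ) ^ t ≤ (N : ℝ) ^ (t + 1) := by
  induction N with
  | zero =>
    have h0 : (0 : ℝ) ^ (t + 1) = 0 := Real.zero_rpow (by linarith)
    simp [h0]
  | succ N ih =>
    rw [Finset.sum_Icc_succ_top (by omega), mul_add]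
    have h := rpow_add_one_sub_rpow_of_nonpos ht ht' (Nat.cast_nonneg N : (0 : ℝ) ≤ N)
      (by linarith : (N : ℝ) ≤ N + 1)
    have h' := (rpow_add_one_sub_rpow_of_nonpos ht ht' (by positivity : (0 : ℝ) ≤ (N : ℝ) + 1)
      (by linarith : (N : ℝ) + 1 ≤ N + 1 + 1)).2 (by positivity)
    push_cast
    simp only [add_sub_cancel_left, mul_one] at h h'
    constructor <;> linarith [h.1, ih.1, ih.2]

/-- For `u ≥ 1` the true error is `O(u ^ t)` if `t ≥ 0` and `O(1)` if `t ≤ 0`; both are absorbed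
when `θ ≤ min 1 (t + 1)`. For `u < 1` the sum is empty and `u ^ (t + 1)` is itself small enough, so
large divisors need no separate treatment later. -/
theorem abs_sum_rpow_sub_le {t u θ : ℝ} (ht : -1 < t) (hu : 0 < u) (hθ : 0 ≤ θ) (hθ1 : θ ≤ 1)
    (hθt : θ ≤ t + 1) :
    |(t + 1) * ∑ j ∈ Finset.Icc 1 ⌊u⌋₊, (j : ℝ) ^ t - u ^ (t + 1)| ≤
      max 1 (t + 1) * u ^ (t + 1 - θ) := by
  have hs : 0 < t + 1 := by linarith
  rcases lt_or_ge u 1 with hu1 | hu1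
  · rw [Nat.floor_eq_zero.2 hu1]
    simp only [zero_lt_one, Finset.Icc_eq_empty_of_lt, Finset.sum_empty, mul_zero, zero_sub,
      abs_neg]
    rw [abs_of_pos (by positivity)]
    calc u ^ (t + 1) ≤ u ^ (t + 1 - θ) := Real.rpow_le_rpow_of_exponent_ge hu hu1.le (by linarith)
      _ ≤ _ := le_mul_of_one_le_left (by positivity) (le_max_left _ _)
  · have hN : (⌊u⌋₊ : ℝ) ≤ u := Nat.floor_le hu.le
    have hN' : u < ⌊u⌋₊ + 1 := Nat.lt_floor_add_one u
    set N := ⌊u⌋₊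
    rcases le_total 0 t with h0 | h0
    · have h1 := sum_rpow_of_nonneg h0 N
      have h2 := (rpow_add_one_sub_rpow_of_nonneg h0 (Nat.cast_nonneg N) hN).2
      have h3 : (N : ℝ) ^ (t + 1) ≤ u ^ (t + 1) :=
        Real.rpow_le_rpow (Nat.cast_nonneg N) hN hs.le
      have h4 : (N : ℝ) ^ t ≤ u ^ t := Real.rpow_le_rpow (Nat.cast_nonneg N) hN h0
      have h5 : (t + 1) * u ^ t * (u - N) ≤ (t + 1) * u ^ t :=
        mul_le_of_le_one_right (by positivity) (by linarith)
      have h6 : (t + 1) * (N : ℝ) ^ t ≤ (t + 1) * u ^ t := by gcongr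
      calc _ ≤ (t + 1) * u ^ t := by
            rw [abs_le]; constructor <;> linarith [h1.1, h1.2]
        _ ≤ (t + 1) * u ^ (t + 1 - θ) := by
            refine mul_le_mul_of_nonneg_left ?_ hs.le
            exact Real.rpow_le_rpow_of_exponent_le hu1 (by linarith)
        _ ≤ _ := by gcongr; exact le_max_right _ _
    · have h1 := sum_rpow_of_nonpos h0 ht N
      have h3 : (N : ℝ) ^ (t + 1) ≤ u ^ (t + 1) :=
        Real.rpow_le_rpow (Nat.cast_nonneg N) hN hs.le
      have h4 : u ^ (t + 1) ≤ ((N : ℝ) + 1) ^ (t + 1) := Real.rpow_le_rpow hu.le hN'.le hs.le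
      calc _ ≤ (1 : ℝ) := by
            rw [abs_le]; constructor <;> linarith [h1.1, h1.2]
        _ ≤ u ^ (t + 1 - θ) := Real.one_le_rpow hu1 (by linarith)
        _ ≤ _ := le_mul_of_one_le_left (by positivity) (le_max_left _ _)

/-- The sum of `(m / x) ^ t` over the multiples `m ≤ x` of `d`. -/
noncomputable def multiplesSum (t : ℝ) (x d : ℕ) : ℝ :=
  ∑ m ∈ Finset.Icc 1 x with d ∣ m, ((m : ℝ) / x) ^ t

theorem multiplesSum_eq (t : ℝ) (x : ℕ) {d : ℕ} (hd : 0 < d) :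
    multiplesSum t x d = ((d : ℝ) / x) ^ t * ∑ j ∈ Finset.Icc 1 (x / d), (j : ℝ) ^ t := by
  rw [multiplesSum, Finset.mul_sum]
  symm
  refine Finset.sum_bij' (fun j _ => j * d) (fun m _ => m / d) ?_ ?_ ?_ ?_ ?_
  · intro j hj
    rw [Finset.mem_Icc] at hj
    rw [Finset.mem_filter, Finset.mem_Icc]
    exact ⟨⟨Nat.mul_pos hj.1 hd, (Nat.le_div_iff_mul_le hd).1 hj.2⟩, dvd_mul_left _ _⟩
  · intro m hm
    rw [Finset.mem_filter, Finset.mem_Icc] at hm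
    rw [Finset.mem_Icc]
    exact ⟨Nat.div_pos (Nat.le_of_dvd hm.1.1 hm.2) hd, Nat.div_le_div_right hm.1.2⟩
  · intro j _
    exact Nat.mul_div_cancel _ hd
  · intro m hm
    exact Nat.div_mul_cancel (Finset.mem_filter.1 hm).2
  · intro j _
    rw [← Real.mul_rpow (by positivity) (by positivity)]
    congr 1
    push_cast
    ring

theorem abs_multiplesSum_sub_one_le {t θ : ℝ} (ht : -1 < t) (hθ : 0 ≤ θ) (hθ1 : θ ≤ 1)
    (hθt : θ ≤ t + 1) {x d : ℕ} (hx : 0 < x) (hd : 0 < d) :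
    |(t + 1) * d / x * multiplesSum t x d - 1| ≤ max 1 (t + 1) * ((d : ℝ) / x) ^ θ := by
  have hx' : (0 : ℝ) < x := by exact_mod_cast hx
  have hd' : (0 : ℝ) < d := by exact_mod_cast hd
  set u : ℝ := x / d with hu
  have hu0 : 0 < u := by positivity
  have h1 := abs_sum_rpow_sub_le ht hu0 hθ hθ1 hθt
  have h2 : ⌊u⌋₊ = x / d := Nat.floor_div_eq_div x d
  rw [h2] at h1
  have h3 : (d : ℝ) / x = u⁻¹ := by rw [hu, inv_div]
  have h4 : (t + 1) * d / x * multiplesSum t x d - 1 =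
      u ^ (-(t + 1)) *
        ((t + 1) * ∑ j ∈ Finset.Icc 1 (x / d), (j : ℝ) ^ t - u ^ (t + 1)) := by
    rw [multiplesSum_eq t x hd, mul_div_assoc, h3, mul_sub, ← Real.rpow_add hu0, neg_add_cancel,
      Real.rpow_zero, Real.inv_rpow hu0.le, neg_add, Real.rpow_add hu0, Real.rpow_neg hu0.le,
      Real.rpow_neg_one]
    ring
  rw [h4, abs_mul, abs_of_pos (by positivity), h3]
  calc _ ≤ u ^ (-(t + 1)) * (max 1 (t + 1) * u ^ (t + 1 - θ)) := by gcongr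
    _ = max 1 (t + 1) * (u ^ (-(t + 1)) * u ^ (t + 1 - θ)) := by ring
    _ = _ := by
      rw [← Real.rpow_add hu0, Real.inv_rpow hu0.le, ← Real.rpow_neg hu0.le]
      congr 2
      ring

theorem exp_sub_one_le_mul_exp (y : ℝ) : Real.exp y - 1 ≤ y * Real.exp y := by
  have h := Real.add_one_le_exp (-y)
  have h1 : Real.exp (-y) * Real.exp y = 1 := by rw [← Real.exp_add]; simp
  nlinarith [Real.exp_pos y]

/-- The crude bound `B` enters only through the exponential, so the estimate stays linear in the
individual deviations, for which a finer bound is available. -/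
theorem abs_prod_sub_one_le {k : ℕ} {b : Fin k → ℝ} {B : ℝ} (hB : ∀ i, |b i - 1| ≤ B) :
    |∏ i, b i - 1| ≤ Real.exp (k * B) * ∑ i, |b i - 1| := by
  have h1 := Finset.univ.norm_prod_one_add_sub_one_le fun i => b i - 1
  simp only [add_sub_cancel, Real.norm_eq_abs] at h1
  have h2 : ∑ i, |b i - 1| ≤ k * B := by
    refine (Finset.sum_le_sum fun i _ => hB i).trans ?_
    simp
  have h3 : 0 ≤ ∑ i, |b i - 1| := Finset.sum_nonneg fun _ _ => abs_nonneg _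
  refine h1.trans ((exp_sub_one_le_mul_exp _).trans ?_)
  rw [mul_comm]
  gcongr

end PowerSums

/-! ### Box averages with a power weight, main term and error -/

section BoxSums

variable {k : ℕ}

theorem mem_boxTuples {x : ℕ} {n : Fin k → ℕ} : n ∈ boxTuples k x ↔ ∀ i, 1 ≤ n i ∧ n i ≤ x := by
  simp [boxTuples]

/-- For a fixed `d` the conditions `d_i ∣ n_i` involve separate coordinates, so the sum over the box
factors. -/
theorem hasSum_lcmCoeff_multiplesSum (r t : ℝ) (x : ℕ) :
    HasSum (fun d : Nat.Primes →₀ (Fin k → ℕ) =>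
      d.prod (lcmCoeff k r) * ∏ i, multiplesSum t x (tupleOf d i))
      (∑ n ∈ boxTuples k x,
        ((tupleLcm n : ℝ) / ∏ i, (n i : ℝ)) ^ r * ∏ i, ((n i : ℝ) / x) ^ t) := by
  classical
  have h := hasSum_sum fun n (hn : n ∈ boxTuples k x) =>
    (hasSum_lcmCoeff_dvd r fun i => (Nat.one_le_iff_ne_zero.1 (mem_boxTuples.1 hn i).1)).mul_right
      (∏ i, ((n i : ℝ) / x) ^ t)
  refine h.congr_fun fun d => ?_
  simp only [multiplesSum]
  rw [Finset.prod_univ_sum, Finset.mul_sum]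
  simp only [ite_mul, zero_mul]
  rw [← Finset.sum_filter]
  refine Finset.sum_congr ?_ fun _ _ => rfl
  ext n
  simp only [Fintype.mem_piFinset, Finset.mem_filter, boxTuples]
  exact forall_and

theorem abs_boxSum_sub_le {r t θ T : ℝ} (ht : -1 < t) (hθ : 0 ≤ θ) (hθ1 : θ ≤ 1)
    (hθt : θ ≤ t + 1) {x : ℕ} (hx : 0 < x)
    (hs : Summable fun d : Nat.Primes →₀ (Fin k → ℕ) =>
      |d.prod (lcmCoeff k r)| / ∏ i, (tupleOf d i : ℝ))
    (hT : ∀ (i : Fin k) (F : Finset (Nat.Primes →₀ (Fin k → ℕ))),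
      ∑ d ∈ F, |d.prod (lcmCoeff k r)| / (∏ j, (tupleOf d j : ℝ)) * (tupleOf d i : ℝ) ^ θ ≤ T) :
    |1 / (x : ℝ) ^ k * ∑ n ∈ boxTuples k x,
        ((tupleLcm n : ℝ) / ∏ i, (n i : ℝ)) ^ r * ∏ i, ((n i : ℝ) / x) ^ t -
      (∑' d : Nat.Primes →₀ (Fin k → ℕ), d.prod (lcmCoeff k r) / ∏ i, (tupleOf d i : ℝ)) /
        (t + 1) ^ k| ≤
      Real.exp (k * max 1 (t + 1)) * max 1 (t + 1) * k * T / (t + 1) ^ k * (x : ℝ) ^ (-θ) := by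
  have hs0 : 0 < t + 1 := by linarith
  have hx' : (0 : ℝ) < x := by exact_mod_cast hx
  have hpos : ∀ (d : Nat.Primes →₀ (Fin k → ℕ)) i, (0 : ℝ) < tupleOf d i :=
    fun d i => by exact_mod_cast tupleOf_pos d i
  have hprod : ∀ d : Nat.Primes →₀ (Fin k → ℕ), 0 < ∏ i, (tupleOf d i : ℝ) :=
    fun d => Finset.prod_pos fun i _ => hpos d i
  set L := max 1 (t + 1) with hL
  have hL0 : 0 < L := lt_max_of_lt_left one_pos
  have hs' : Summable fun d : Nat.Primes →₀ (Fin k → ℕ) =>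
      d.prod (lcmCoeff k r) / ∏ i, (tupleOf d i : ℝ) := by
    refine Summable.of_abs (hs.congr fun d => ?_)
    rw [abs_div, abs_of_pos (hprod d)]
  have h1 := ((hasSum_lcmCoeff_multiplesSum (k := k) r t x).mul_left (1 / (x : ℝ) ^ k)).sub
    (hs'.hasSum.div_const ((t + 1) ^ k))
  have h2 : ∀ d : Nat.Primes →₀ (Fin k → ℕ),
      1 / (x : ℝ) ^ k * (d.prod (lcmCoeff k r) * ∏ i, multiplesSum t x (tupleOf d i)) -
        d.prod (lcmCoeff k r) / (∏ i, (tupleOf d i : ℝ)) / (t + 1) ^ k =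
      d.prod (lcmCoeff k r) / (∏ i, (tupleOf d i : ℝ)) / (t + 1) ^ k *
        (∏ i, ((t + 1) * tupleOf d i / x * multiplesSum t x (tupleOf d i)) - 1) := by
    intro d
    rw [Finset.prod_mul_distrib, Finset.prod_div_distrib, Finset.prod_mul_distrib,
      Finset.prod_const, Finset.prod_const, Finset.card_univ, Fintype.card_fin]
    have := (hprod d).ne'
    field_simp
  have h3 : ∀ d : Nat.Primes →₀ (Fin k → ℕ),
      |1 / (x : ℝ) ^ k * (d.prod (lcmCoeff k r) * ∏ i, multiplesSum t x (tupleOf d i)) -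
        d.prod (lcmCoeff k r) / (∏ i, (tupleOf d i : ℝ)) / (t + 1) ^ k| ≤
      Real.exp (k * L) * L / (t + 1) ^ k * (x : ℝ) ^ (-θ) *
        ∑ i, |d.prod (lcmCoeff k r)| / (∏ j, (tupleOf d j : ℝ)) * (tupleOf d i : ℝ) ^ θ := by
    intro d
    rw [h2, abs_mul, abs_div, abs_div, abs_of_pos (hprod d),
      abs_of_pos (by positivity : 0 < (t + 1) ^ k)]
    -- The choice `θ = 0` shows that every factor is within `L` of `1`, uniformly in `d`; this fixes
    -- the constant `exp (k * L)`.
    have h4 := abs_prod_sub_one_le (B := L)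
      (b := fun i => (t + 1) * tupleOf d i / x * multiplesSum t x (tupleOf d i)) fun i => by
        have := abs_multiplesSum_sub_one_le ht le_rfl zero_le_one hs0.le hx (tupleOf_pos d i)
        rwa [Real.rpow_zero, mul_one] at this
    have h5 : ∀ i, |(t + 1) * tupleOf d i / x * multiplesSum t x (tupleOf d i) - 1| ≤
        L * ((tupleOf d i : ℝ) / x) ^ θ := fun i =>
      abs_multiplesSum_sub_one_le ht hθ hθ1 hθt hx (tupleOf_pos d i)
    have h6 := (hprod d).le
    calc _ ≤ |d.prod (lcmCoeff k r)| / (∏ i, (tupleOf d i : ℝ)) / (t + 1) ^ k *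
          (Real.exp (k * L) * ∑ i, L * ((tupleOf d i : ℝ) / x) ^ θ) := by
          refine mul_le_mul_of_nonneg_left (h4.trans ?_) (by positivity)
          exact mul_le_mul_of_nonneg_left (Finset.sum_le_sum fun i _ => h5 i) (by positivity)
      _ = _ := by
          rw [Finset.mul_sum, Finset.mul_sum, Finset.mul_sum]
          refine Finset.sum_congr rfl fun i _ => ?_
          rw [Real.div_rpow (hpos d i).le hx'.le, Real.rpow_neg hx'.le]
          ring
  have hTs : ∀ F : Finset (Nat.Primes →₀ (Fin k → ℕ)),
      ∑ d ∈ F, ∑ i, |d.prod (lcmCoeff k r)| / (∏ j, (tupleOf d j : ℝ)) * (tupleOf d i : ℝ) ^ θ ≤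
        k * T := by
    intro F
    rw [Finset.sum_comm]
    refine (Finset.sum_le_sum fun i _ => hT i F).trans ?_
    simp
  rw [← h1.tsum_eq]
  have hnonneg : 0 ≤ Real.exp (k * L) * L / (t + 1) ^ k * (x : ℝ) ^ (-θ) := by positivity
  have h7 : Summable fun d : Nat.Primes →₀ (Fin k → ℕ) =>
      Real.exp (k * L) * L / (t + 1) ^ k * (x : ℝ) ^ (-θ) *
        ∑ i, |d.prod (lcmCoeff k r)| / (∏ j, (tupleOf d j : ℝ)) * (tupleOf d i : ℝ) ^ θ := by
    refine Summable.mul_left _ (summable_of_sum_le (c := k * T) (fun d => ?_) hTs)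
    have := (hprod d).le
    exact Finset.sum_nonneg fun i _ => by positivity
  refine (tsum_of_norm_bounded (f := fun d : Nat.Primes →₀ (Fin k → ℕ) =>
    1 / (x : ℝ) ^ k * (d.prod (lcmCoeff k r) * ∏ i, multiplesSum t x (tupleOf d i)) -
      d.prod (lcmCoeff k r) / (∏ i, (tupleOf d i : ℝ)) / (t + 1) ^ k) h7.hasSum h3).trans ?_
  rw [tsum_mul_left]
  calc _ ≤ Real.exp (k * L) * L / (t + 1) ^ k * (x : ℝ) ^ (-θ) * (k * T) := by
        refine mul_le_mul_of_nonneg_left ?_ hnonneg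
        refine Real.tsum_le_of_sum_le (fun d => ?_) hTs
        have := (hprod d).le
        exact Finset.sum_nonneg fun i _ => by positivity
    _ = _ := by ring

end BoxSums

/-! ### The prime zeta function near `1` -/

section PrimeZeta

theorem summable_primes_rpow {s : ℝ} (hs : 1 < s) :
    Summable fun p : Nat.Primes => ((p : ℕ) : ℝ) ^ (-s) :=
  Nat.Primes.summable_rpow.2 (by linarith)

theorem mul_sum_rpow_le {η : ℝ} (hη : 0 < η) (N : ℕ) :
    η * ∑ j ∈ Finset.Icc 1 (N + 1), (j : ℝ) ^ (-(1 + η)) ≤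
      η + 1 - ((N : ℝ) + 1) ^ (-η) := by
  induction N with
  | zero => simp
  | succ N ih =>
    rw [Finset.sum_Icc_succ_top (by omega), mul_add]
    have hpos : ∀ y : ℝ, (N : ℝ) + 1 ≤ y → 0 < y := fun y hy =>
      lt_of_lt_of_le (by positivity) hy
    obtain ⟨c, hc, h⟩ := exists_hasDerivAt_eq_slope (fun y : ℝ => y ^ (-η))
      (fun y => -η * y ^ (-η - 1)) (by linarith : (N : ℝ) + 1 < N + 1 + 1)
      (ContinuousOn.rpow_const continuousOn_id fun y hy => Or.inl (hpos y hy.1).ne')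
      fun y hy => Real.hasDerivAt_rpow_const (Or.inl (hpos y hy.1.le).ne')
    have hc0 : 0 < c := lt_trans (by positivity) hc.1
    have h1 : ((N : ℝ) + 1 + 1) ^ (-η - 1) ≤ c ^ (-η - 1) :=
      Real.rpow_le_rpow_of_nonpos hc0 hc.2.le (by linarith)
    have h2 : η * ((N : ℝ) + 1 + 1) ^ (-η - 1) ≤ η * c ^ (-η - 1) := by gcongr
    simp only [add_sub_cancel_left, div_one] at h
    have h3 : -(1 + η) = -η - 1 := by ring
    push_cast
    rw [h3] at ih ⊢
    linarith

theorem tsum_nat_rpow_le {η : ℝ} (hη : 0 < η) :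
    ∑' n : ℕ, (n : ℝ) ^ (-(1 + η)) ≤ 1 + 1 / η := by
  refine Real.tsum_le_of_sum_range_le (fun n => by positivity) fun n => ?_
  have h0 : (0 : ℝ) ^ (-(1 + η)) = 0 := Real.zero_rpow (by linarith)
  have h1 : ∑ j ∈ Finset.range n, (j : ℝ) ^ (-(1 + η)) ≤
      ∑ j ∈ Finset.Icc 1 (n + 1), (j : ℝ) ^ (-(1 + η)) := by
    have : Finset.range n ⊆ insert 0 (Finset.Icc 1 (n + 1)) := by
      intro j hj
      simp only [Finset.mem_range, Finset.mem_insert, Finset.mem_Icc] at hj ⊢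
      omega
    refine (Finset.sum_le_sum_of_subset_of_nonneg this fun _ _ _ => by positivity).trans ?_
    rw [Finset.sum_insert (by simp)]
    rw [Nat.cast_zero, h0, zero_add]
  have h2 := mul_sum_rpow_le hη n
  have h3 : 0 ≤ ((n : ℝ) + 1) ^ (-η) := by positivity
  refine h1.trans ?_
  rw [← mul_le_mul_iff_right₀ hη, mul_add, mul_one_div_cancel hη.ne']
  linarith

/-- Since `exp y ≤ 1 / (1 - y)`, the exponential of the prime sum is at most the Euler product of
`ζ(1 + η)`. Each such factor later costs one logarithm. -/
theorem exp_tsum_primes_rpow_le {η : ℝ} (hη : 0 < η) :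
    Real.exp (∑' p : Nat.Primes, ((p : ℕ) : ℝ) ^ (-(1 + η))) ≤ 1 + 1 / η := by
  let f : ℕ →*₀ ℝ :=
    { toFun := fun n => (n : ℝ) ^ (-(1 + η))
      map_zero' := by simp only [Nat.cast_zero]; exact Real.zero_rpow (by linarith)
      map_one' := by simp
      map_mul' := fun m n => by
        push_cast
        exact Real.mul_rpow (Nat.cast_nonneg m) (Nat.cast_nonneg n) }
  have hf : Summable fun n => ‖f n‖ := by
    refine (Real.summable_nat_rpow.2 (by linarith : -(1 + η) < -1)).congr fun n => ?_
    exact (Real.norm_of_nonneg (by positivity)).symm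
  have h1 := EulerProduct.eulerProduct_completely_multiplicative_hasProd hf
  have hlt : ∀ p : Nat.Primes, f p < 1 := fun p =>
    Real.rpow_lt_one_of_one_lt_of_neg (by exact_mod_cast p.2.one_lt) (by linarith)
  have hnn : ∀ p : Nat.Primes, 0 ≤ f p := fun p => by
    change 0 ≤ ((p : ℕ) : ℝ) ^ (-(1 + η))
    positivity
  refine le_trans ?_ (tsum_nat_rpow_le hη)
  have h2 : HasProd (fun p : Nat.Primes => Real.exp (f p))
      (Real.exp (∑' p : Nat.Primes, f p)) :=
    ((summable_primes_rpow (by linarith : 1 < 1 + η)).hasSum).rexp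
  refine le_of_tendsto_of_tendsto' h2 h1 fun S => ?_
  refine Finset.prod_le_prod (fun p _ => (Real.exp_pos _).le) fun p _ => ?_
  have h3 := Real.add_one_le_exp (-f p)
  have h4 : 0 < 1 - f p := by linarith [hlt p]
  rw [← inv_inv (Real.exp (f p)), ← Real.exp_neg]
  exact inv_anti₀ h4 (by linarith)

end PrimeZeta

/-! ### Local coefficients at one prime -/

section LocalBounds

variable {k : ℕ}

theorem summable_pow_sum {ρ : ℝ} (h0 : 0 ≤ ρ) (h1 : ρ < 1) :
    Summable fun a : Fin k → ℕ => ρ ^ ∑ i, a i := by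
  have hg : Summable fun n : ℕ => |ρ ^ n| :=
    (summable_geometric_of_lt_one h0 h1).congr fun n => (abs_of_nonneg (by positivity)).symm
  have hs : Summable fun x : Fin k × {a : ℕ // a ≠ 0} => |ρ ^ x.2.1| := by
    have h := (Summable.of_finite (f := fun _ : Fin k => (1 : ℝ))).mul_of_nonneg
      (hg.comp_injective (i := fun a : {a : ℕ // a ≠ 0} => a.1) Subtype.val_injective)
      (fun _ => zero_le_one) fun _ => abs_nonneg _
    exact h.congr fun x => one_mul _
  have h2 := (summable_norm_finsupp_prod (w := fun _ : Fin k => fun a : ℕ => ρ ^ a) hs).of_abs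
  refine (Finsupp.equivFunOnFinite.symm.summable_iff.2 h2).congr fun a => ?_
  simp only [Function.comp]
  rw [Finsupp.prod_fintype _ _ fun _ => pow_zero _, Finset.prod_pow_eq_pow_sum]
  simp

theorem two_le_prime (p : Nat.Primes) : (2 : ℝ) ≤ (p : ℕ) := by exact_mod_cast p.2.two_le

theorem prime_pos (p : Nat.Primes) : (0 : ℝ) < (p : ℕ) := by exact_mod_cast p.2.pos

theorem sum_sub_le_of_lcmCoeff_ne_zero {r : ℝ} {p : Nat.Primes} {a : Fin k → ℕ} (ha : a ≠ 0)
    (h : lcmCoeff k r p a ≠ 0) (i : Fin k) :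
    Finset.univ.sup a ≤ ∑ j ∈ Finset.univ.erase i, a j := by
  obtain ⟨j, hji, hj⟩ := exists_ne_eq_sup_of_mixedDiff_ne_zero
    (G := fun e => (((p : ℕ) : ℝ) ^ (-r)) ^ e) ha h i
  rw [← hj]
  exact Finset.single_le_sum (f := a) (fun _ _ => Nat.zero_le _)
    (Finset.mem_erase.2 ⟨hji, Finset.mem_univ j⟩)

/-- The excess is the sum of all entries but one maximal one, and a second maximal entry remains in
it. -/
theorem sup_le_excess_of_lcmCoeff_ne_zero {r : ℝ} {p : Nat.Primes} {a : Fin k → ℕ} (ha : a ≠ 0)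
    (h : lcmCoeff k r p a ≠ 0) : Finset.univ.sup a ≤ excess a := by
  obtain ⟨i, -⟩ := Function.ne_iff.1 ha
  obtain ⟨l, -, hl⟩ := Finset.exists_mem_eq_sup Finset.univ ⟨i, Finset.mem_univ i⟩ a
  rw [excess_eq_sum_erase (i := l) fun j => hl ▸ Finset.le_sup (Finset.mem_univ j)]
  exact sum_sub_le_of_lcmCoeff_ne_zero ha h l

theorem one_le_sup {a : Fin k → ℕ} (ha : a ≠ 0) : 1 ≤ Finset.univ.sup a := by
  obtain ⟨i, hi⟩ := Function.ne_iff.1 ha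
  exact (Nat.one_le_iff_ne_zero.2 hi).trans (Finset.le_sup (Finset.mem_univ i))

theorem abs_lcmCoeff_le_of_nonpos {r : ℝ} (hr : r ≤ 0) (p : Nat.Primes) (a : Fin k → ℕ) :
    |lcmCoeff k r p a| ≤ 2 ^ k * (((p : ℕ) : ℝ) ^ (-r)) ^ excess a := by
  have hp := prime_pos p
  refine abs_mixedDiff_le (by positivity) fun b hb => ?_
  rw [abs_of_pos (by positivity)]
  exact pow_le_pow_right₀ (Real.one_le_rpow (by linarith [two_le_prime p]) (by linarith))
    (excess_mono hb)

theorem abs_lcmCoeff_le_of_nonneg {r : ℝ} (hr : 0 ≤ r) (p : Nat.Primes) (a : Fin k → ℕ) :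
    |lcmCoeff k r p a| ≤ 2 ^ k := by
  have hp := prime_pos p
  rw [← mul_one ((2 : ℝ) ^ k)]
  refine abs_mixedDiff_le zero_le_one fun b _ => ?_
  rw [abs_of_pos (by positivity)]
  exact pow_le_one₀ (by positivity)
    (Real.rpow_le_one_of_one_le_of_nonpos (by linarith [two_le_prime p]) (by linarith))

theorem abs_lcmCoeff_pair_le {r : ℝ} (hr : 0 ≤ r) (p : Nat.Primes) {i j : Fin k} (hij : i ≠ j) :
    |lcmCoeff k r p (natIndicator {i, j})| ≤ 1 := by
  have hp := prime_pos p
  rw [lcmCoeff, mixedDiff_natIndicator_pair _ hij, excess_natIndicator_pair hij,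
    excess_natIndicator_singleton, excess_natIndicator_singleton, excess_zero, abs_le]
  have h1 : 0 ≤ ((p : ℕ) : ℝ) ^ (-r) := by positivity
  have h2 : ((p : ℕ) : ℝ) ^ (-r) ≤ 1 :=
    Real.rpow_le_one_of_one_le_of_nonpos (by linarith [two_le_prime p]) (by linarith)
  constructor <;> simp <;> linarith

/-- The local factor of `|g(d)| / (d₁ ⋯ d_k) * d_i ^ θ`. -/
noncomputable def weightedCoeff (k : ℕ) (r θ : ℝ) (i : Fin k) (p : Nat.Primes)
    (a : Fin k → ℕ) : ℝ :=
  |lcmCoeff k r p a| / ((p : ℕ) : ℝ) ^ (∑ j, a j) * (((p : ℕ) : ℝ) ^ a i) ^ θ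

theorem weightedCoeff_nonneg (r θ : ℝ) (i : Fin k) (p : Nat.Primes) (a : Fin k → ℕ) :
    0 ≤ weightedCoeff k r θ i p a := by
  unfold weightedCoeff
  positivity

/-- With `M` the maximum and `e` the excess, the exponent of `p` is at most `-2θe - (1 - θ)M`. The
claimed exponent `-(1 + θ) - θ(e + M - 2)` exceeds this by `θ(e - M) + (1 - θ)(M - 1)`, which is
nonnegative because `1 ≤ M ≤ e`. -/
theorem weightedCoeff_le_of_nonpos {r θ : ℝ} (hr : r ≤ 0) (hθ : θ = (r + 1) / 2)
    (hθ0 : 0 < θ) (i : Fin k) (p : Nat.Primes) {a : Fin k → ℕ} (ha : a ≠ 0) :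
    weightedCoeff k r θ i p a ≤
      2 ^ k * 2 ^ (2 * θ) * (((p : ℕ) : ℝ) ^ (-(1 + θ)) * ((2 : ℝ) ^ (-θ)) ^ ∑ j, a j) := by
  have hp := prime_pos p
  by_cases hg : lcmCoeff k r p a = 0
  · rw [weightedCoeff, hg]
    simp only [abs_zero, zero_div, zero_mul]
    positivity
  have h1 : ((excess a : ℕ) : ℝ) + (Finset.univ.sup a : ℕ) = (∑ j, a j : ℕ) := by
    exact_mod_cast excess_add_sup a
  have h2 : ((Finset.univ.sup a : ℕ) : ℝ) ≤ excess a := by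
    exact_mod_cast sup_le_excess_of_lcmCoeff_ne_zero ha hg
  have h3 : (1 : ℝ) ≤ (Finset.univ.sup a : ℕ) := by exact_mod_cast one_le_sup ha
  have h4 : (a i : ℝ) ≤ (Finset.univ.sup a : ℕ) := by
    exact_mod_cast Finset.le_sup (Finset.mem_univ i)
  set M : ℝ := ((Finset.univ.sup a : ℕ) : ℝ)
  set N : ℕ := ∑ j, a j
  set e : ℝ := (excess a : ℝ) with he
  calc weightedCoeff k r θ i p a
      ≤ 2 ^ k * (((p : ℕ) : ℝ) ^ (-r)) ^ excess a / ((p : ℕ) : ℝ) ^ N *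
        (((p : ℕ) : ℝ) ^ a i) ^ θ := by
        unfold weightedCoeff
        gcongr
        exact abs_lcmCoeff_le_of_nonpos hr p a
    _ = 2 ^ k * ((p : ℕ) : ℝ) ^ (-r * e - N + a i * θ) := by
        rw [Real.rpow_add hp, Real.rpow_sub hp, he, Real.rpow_mul hp.le, Real.rpow_natCast,
          Real.rpow_natCast, Real.rpow_mul hp.le, Real.rpow_natCast]
        ring
    _ ≤ 2 ^ k * ((p : ℕ) : ℝ) ^ (-(1 + θ) + -θ * (N - 2)) := by
        refine mul_le_mul_of_nonneg_left
          (Real.rpow_le_rpow_of_exponent_le (by linarith [two_le_prime p]) ?_) (by positivity)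
        have h5 : r = 2 * θ - 1 := by linarith
        have h6 : 0 ≤ 1 - 2 * θ := by linarith
        rw [← h1, h5]
        nlinarith [mul_le_mul_of_nonneg_right h4 hθ0.le,
          mul_nonneg hθ0.le (sub_nonneg.2 h2), mul_nonneg h6 (sub_nonneg.2 h3)]
    _ = 2 ^ k * (((p : ℕ) : ℝ) ^ (-(1 + θ)) * ((p : ℕ) : ℝ) ^ (-θ * (N - 2))) := by
        rw [Real.rpow_add hp]
    -- Replacing the base `p` by `2` makes the decay in `a` independent of `p`, so the double sum
    -- over `p` and `a` factors.
    _ ≤ 2 ^ k * (((p : ℕ) : ℝ) ^ (-(1 + θ)) * (2 : ℝ) ^ (-θ * (N - 2))) := by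
        have h5 : -θ * ((N : ℝ) - 2) ≤ 0 := by
          rw [← h1]; nlinarith
        have := Real.rpow_le_rpow_of_nonpos two_pos (two_le_prime p) h5
        gcongr
    _ = _ := by
        have : -θ * ((N : ℝ) - 2) = 2 * θ + -θ * N := by ring
        rw [this, Real.rpow_add two_pos, Real.rpow_mul two_pos.le (-θ), Real.rpow_natCast]
        ring

-- Let `m` be the sum of the entries other than `a i`; the power of `p` is `-m - η a i`. If `m = 1`,
-- the doubly attained maximum forces `a` to be the indicator of a pair `{i, j}`. If `m ≥ 2`, the
-- maximum is at most `m`, so the full sum is at most `2m` and `p ^ (-m)` yields both `p ^ (-2)` and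
-- geometric decay.
open Classical in
theorem weightedCoeff_le_of_nonneg {r η : ℝ} (hr : 0 ≤ r) (hη : 0 ≤ η) (i : Fin k)
    (p : Nat.Primes) {a : Fin k → ℕ} (ha : a ≠ 0) :
    weightedCoeff k r (1 - η) i p a ≤
      ∑ j ∈ Finset.univ.erase i,
        (if a = natIndicator {i, j} then ((p : ℕ) : ℝ) ^ (-(1 + η)) else 0) +
      2 ^ k * 2 ^ (2 : ℕ) *
        (((p : ℕ) : ℝ) ^ (-(1 + 1) : ℝ) * ((2 : ℝ) ^ (-(1 / 2) : ℝ)) ^ ∑ j, a j) := by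
  have hp := prime_pos p
  have hp2 := two_le_prime p
  have hsum0 : 0 ≤ ∑ j ∈ Finset.univ.erase i,
      (if a = natIndicator {i, j} then ((p : ℕ) : ℝ) ^ (-(1 + η)) else 0) :=
    Finset.sum_nonneg fun j _ => by split_ifs <;> positivity
  by_cases hg : lcmCoeff k r p a = 0
  · rw [weightedCoeff, hg]
    simp only [abs_zero, zero_div, zero_mul]
    positivity
  have hsup := sum_sub_le_of_lcmCoeff_ne_zero ha hg i
  have hsum := Finset.add_sum_erase Finset.univ a (Finset.mem_univ i)
  have h1 := one_le_sup ha
  have hai : a i ≤ Finset.univ.sup a := Finset.le_sup (Finset.mem_univ i)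
  have hw : weightedCoeff k r (1 - η) i p a =
      |lcmCoeff k r p a| * ((p : ℕ) : ℝ) ^ (-((∑ j ∈ Finset.univ.erase i, a j : ℕ) : ℝ) -
        a i * η) := by
    have : -((∑ j ∈ Finset.univ.erase i, a j : ℕ) : ℝ) - a i * η =
        -((∑ j, a j : ℕ) : ℝ) + a i * (1 - η) := by
      rw [← hsum]; push_cast; ring
    rw [this, Real.rpow_add hp, Real.rpow_neg hp.le, Real.rpow_natCast, Real.rpow_mul hp.le,
      Real.rpow_natCast, weightedCoeff]
    ring
  rcases Nat.lt_or_ge (∑ j ∈ Finset.univ.erase i, a j) 2 with hm | hm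
  · obtain ⟨j, hji, hj⟩ := exists_ne_eq_sup_of_mixedDiff_ne_zero
      (G := fun e => (((p : ℕ) : ℝ) ^ (-r)) ^ e) ha hg i
    have hj1 : a j = 1 := by omega
    have hother : ∀ l, l ≠ i → l ≠ j → a l = 0 := by
      intro l hli hlj
      have h2 := Finset.add_sum_erase (Finset.univ.erase i) a
        (Finset.mem_erase.2 ⟨hji, Finset.mem_univ j⟩)
      have h3 : a l ≤ ∑ m ∈ (Finset.univ.erase i).erase j, a m :=
        Finset.single_le_sum (f := a) (fun _ _ => Nat.zero_le _)
          (Finset.mem_erase.2 ⟨hlj, Finset.mem_erase.2 ⟨hli, Finset.mem_univ l⟩⟩)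
      omega
    obtain ⟨l, hlj, hl⟩ := exists_ne_eq_sup_of_mixedDiff_ne_zero
      (G := fun e => (((p : ℕ) : ℝ) ^ (-r)) ^ e) ha hg j
    have hli : l = i := by
      by_contra hc
      have := hother l hc hlj
      omega
    have hi1 : a i = 1 := by rw [← hli]; omega
    have hae : a = natIndicator {i, j} := by
      ext l
      by_cases h2 : l = i
      · simp [natIndicator, h2, hi1]
      · by_cases h3 : l = j
        · simp [natIndicator, h3, hj1]
        · simp [natIndicator, h2, h3, hother l h2 h3]
    have h5 : ∑ j ∈ Finset.univ.erase i, a j = 1 := by omega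
    have h4 : weightedCoeff k r (1 - η) i p a ≤ ((p : ℕ) : ℝ) ^ (-(1 + η)) := by
      rw [hw, h5, hi1]
      have h6 : -((1 : ℕ) : ℝ) - (1 : ℕ) * η = -(1 + η) := by push_cast; ring
      rw [h6]
      refine mul_le_of_le_one_left (by positivity) ?_
      rw [hae]
      exact abs_lcmCoeff_pair_le hr p hji.symm
    have h7 := Finset.single_le_sum (f := fun j =>
      if a = natIndicator {i, j} then ((p : ℕ) : ℝ) ^ (-(1 + η)) else 0)
      (fun j _ => by split_ifs <;> positivity)
      (Finset.mem_erase.2 ⟨hji, Finset.mem_univ j⟩)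
    simp only [if_pos hae] at h7
    refine h4.trans (h7.trans (le_add_of_nonneg_right (by positivity)))
  · refine le_add_of_nonneg_of_le hsum0 ?_
    set m := ∑ j ∈ Finset.univ.erase i, a j
    have hm' : (2 : ℝ) ≤ m := by exact_mod_cast hm
    have hN : ((∑ j, a j : ℕ) : ℝ) ≤ 2 * m := by
      have : ∑ j, a j ≤ 2 * m := by omega
      exact_mod_cast this
    set N := ∑ j, a j
    calc weightedCoeff k r (1 - η) i p a ≤ 2 ^ k * ((p : ℕ) : ℝ) ^ (-(1 + 1) + -((m : ℝ) - 2)) := by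
          rw [hw]
          gcongr
          · exact abs_lcmCoeff_le_of_nonneg hr p a
          · linarith
          · have : 0 ≤ (a i : ℝ) * η := by positivity
            linarith
      _ = 2 ^ k * (((p : ℕ) : ℝ) ^ (-(1 + 1) : ℝ) * ((p : ℕ) : ℝ) ^ (-((m : ℝ) - 2))) := by
          rw [Real.rpow_add hp]
      _ ≤ 2 ^ k * (((p : ℕ) : ℝ) ^ (-(1 + 1) : ℝ) * (2 : ℝ) ^ (-((m : ℝ) - 2))) := by
          have := Real.rpow_le_rpow_of_nonpos two_pos hp2 (by linarith : -((m : ℝ) - 2) ≤ 0)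
          gcongr
      _ ≤ 2 ^ k * (((p : ℕ) : ℝ) ^ (-(1 + 1) : ℝ) * (2 : ℝ) ^ ((2 : ℕ) + -(1 / 2) * (N : ℝ))) := by
          gcongr
          · norm_num
          · push_cast; linarith
      _ = _ := by
          rw [Real.rpow_add two_pos, Real.rpow_natCast, Real.rpow_mul two_pos.le,
            Real.rpow_natCast]
          ring

end LocalBounds

/-! ### Weighted sums of the coefficients and the Euler product of the constant -/

section GlobalBounds

variable {k : ℕ}

theorem prod_weightedCoeff (r θ : ℝ) (i : Fin k) (d : Nat.Primes →₀ (Fin k → ℕ)) :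
    d.prod (weightedCoeff k r θ i) =
      |d.prod (lcmCoeff k r)| / (∏ j, (tupleOf d j : ℝ)) * (tupleOf d i : ℝ) ^ θ := by
  have h1 : |d.prod (lcmCoeff k r)| = ∏ p ∈ d.support, |lcmCoeff k r p (d p)| :=
    Finset.abs_prod _ _
  have h2 : ∏ j, (tupleOf d j : ℝ) = ∏ p ∈ d.support, ((p : ℕ) : ℝ) ^ ∑ j, d p j := by
    simp only [tupleOf, Finsupp.prod]
    push_cast
    rw [Finset.prod_comm]
    exact Finset.prod_congr rfl fun p _ => Finset.prod_pow_eq_pow_sum _ _ _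
  have h3 : (tupleOf d i : ℝ) ^ θ = ∏ p ∈ d.support, (((p : ℕ) : ℝ) ^ d p i) ^ θ := by
    simp only [tupleOf, Finsupp.prod]
    push_cast
    rw [Real.finsetProd_rpow _ _ fun p _ => by positivity]
  rw [h1, h2, h3, ← Finset.prod_div_distrib, ← Finset.prod_mul_distrib]
  rfl

theorem sum_weighted_le {r θ B : ℝ} {i : Fin k} {h : Nat.Primes × (Fin k → ℕ) → ℝ}
    (hh0 : ∀ x, 0 ≤ h x) (hh : HasSum h B)
    (hle : ∀ p a, a ≠ 0 → weightedCoeff k r θ i p a ≤ h (p, a))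
    (F : Finset (Nat.Primes →₀ (Fin k → ℕ))) :
    ∑ d ∈ F, |d.prod (lcmCoeff k r)| / (∏ j, (tupleOf d j : ℝ)) * (tupleOf d i : ℝ) ^ θ ≤
      Real.exp B := by
  simp_rw [← prod_weightedCoeff]
  refine sum_finsupp_prod_le (weightedCoeff_nonneg r θ i) (fun s hs => ?_) F
  exact (Finset.sum_le_sum fun x hx => hle x.1 x.2 (hs x hx)).trans
    (sum_le_hasSum s (fun x _ => hh0 x) hh)

theorem summable_lcmCoeff_div_of_le {r θ B : ℝ} (hθ : 0 ≤ θ) {i : Fin k}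
    {h : Nat.Primes × (Fin k → ℕ) → ℝ} (hh : HasSum h B)
    (hle : ∀ p a, a ≠ 0 → weightedCoeff k r θ i p a ≤ h (p, a)) :
    Summable fun x : Nat.Primes × {a : Fin k → ℕ // a ≠ 0} =>
      |lcmCoeff k r x.1 x.2 * (1 / ((x.1 : ℕ) : ℝ)) ^ ∑ j, x.2.1 j| := by
  have h1 : Summable fun x : Nat.Primes × {a : Fin k → ℕ // a ≠ 0} => h (x.1, x.2.1) := by
    refine hh.summable.comp_injective (i := fun x : Nat.Primes × {a : Fin k → ℕ // a ≠ 0} =>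
      (x.1, x.2.1)) ?_
    rintro ⟨p, a, ha⟩ ⟨q, b, hb⟩ hab
    simpa using hab
  refine h1.of_nonneg_of_le (fun _ => abs_nonneg _) fun x => le_trans ?_ (hle x.1 x.2.1 x.2.2)
  have hp := prime_pos x.1
  rw [weightedCoeff, abs_mul, one_div, inv_pow, abs_of_pos (by positivity : 0 <
    (((x.1 : ℕ) : ℝ) ^ ∑ j, x.2.1 j)⁻¹), ← div_eq_mul_inv]
  refine le_mul_of_one_le_right (by positivity) (Real.one_le_rpow ?_ hθ)
  exact one_le_pow₀ (by linarith [two_le_prime x.1])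

theorem hasSum_primes_mul_pow_sum {C s ρ : ℝ} (hs : 1 < s) (h0 : 0 ≤ ρ) (h1 : ρ < 1) :
    HasSum (fun x : Nat.Primes × (Fin k → ℕ) =>
      C * (((x.1 : ℕ) : ℝ) ^ (-s) * ρ ^ ∑ j, x.2 j))
      (C * ((∑' p : Nat.Primes, ((p : ℕ) : ℝ) ^ (-s)) * ∑' a : Fin k → ℕ, ρ ^ ∑ j, a j)) := by
  have h2 := summable_primes_rpow hs
  have h3 := summable_pow_sum (k := k) h0 h1
  have h4 : Summable fun x : Nat.Primes × (Fin k → ℕ) =>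
      ((x.1 : ℕ) : ℝ) ^ (-s) * ρ ^ ∑ j, x.2 j :=
    Summable.mul_of_nonneg (f := fun p : Nat.Primes => ((p : ℕ) : ℝ) ^ (-s))
      (g := fun a : Fin k → ℕ => ρ ^ ∑ j, a j) h2 h3
      (fun p => by positivity) fun a => by positivity
  exact (h2.hasSum.mul h3.hasSum h4).mul_left C

open Classical in
theorem hasSum_primes_single {s : ℝ} (hs : 1 < s) (b : Fin k → ℕ) :
    HasSum (fun x : Nat.Primes × (Fin k → ℕ) => if x.2 = b then ((x.1 : ℕ) : ℝ) ^ (-s) else 0)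
      (∑' p : Nat.Primes, ((p : ℕ) : ℝ) ^ (-s)) := by
  have hinj : Function.Injective fun p : Nat.Primes => (p, b) := fun p q h => (Prod.mk.inj h).1
  refine (hinj.hasSum_iff ?_).1 ?_
  · rintro ⟨p, a⟩ hx
    exact if_neg fun h => hx ⟨p, by rw [← h]⟩
  · exact (summable_primes_rpow hs).hasSum.congr_fun fun p => by simp

theorem two_rpow_neg_lt_one {θ : ℝ} (hθ : 0 < θ) : (2 : ℝ) ^ (-θ) < 1 :=
  Real.rpow_lt_one_of_one_lt_of_neg one_lt_two (by linarith)

/-- Weighted sums of the coefficients for `-1 < r ≤ 0`. -/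
theorem exists_weighted_le_of_nonpos (k : ℕ) {r : ℝ} (hr' : -1 < r) (hr : r ≤ 0) :
    ∃ T : ℝ, ∀ (i : Fin k) (F : Finset (Nat.Primes →₀ (Fin k → ℕ))),
      ∑ d ∈ F, |d.prod (lcmCoeff k r)| / (∏ j, (tupleOf d j : ℝ)) *
        (tupleOf d i : ℝ) ^ ((r + 1) / 2) ≤ T := by
  have hθ : 0 < (r + 1) / 2 := by linarith
  refine ⟨_, fun i F => sum_weighted_le (fun x => ?_)
    (hasSum_primes_mul_pow_sum (k := k) (C := 2 ^ k * 2 ^ (2 * ((r + 1) / 2)))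
      (by linarith : 1 < 1 + (r + 1) / 2) (by positivity) (two_rpow_neg_lt_one hθ))
    (fun p a ha => weightedCoeff_le_of_nonpos hr rfl hθ i p ha) F⟩
  positivity

/-- Weighted sums of the coefficients for `r ≥ 0`. -/
theorem exists_weighted_le_of_nonneg (k : ℕ) {r : ℝ} (hr : 0 ≤ r) :
    ∃ C : ℝ, ∀ (η : ℝ), 0 < η → ∀ (i : Fin k) (F : Finset (Nat.Primes →₀ (Fin k → ℕ))),
      ∑ d ∈ F, |d.prod (lcmCoeff k r)| / (∏ j, (tupleOf d j : ℝ)) *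
        (tupleOf d i : ℝ) ^ (1 - η) ≤ C * (1 + 1 / η) ^ (k - 1) := by
  classical
  set B : ℝ := 2 ^ k * 2 ^ (2 : ℕ) * ((∑' p : Nat.Primes, ((p : ℕ) : ℝ) ^ (-(1 + 1) : ℝ)) *
    ∑' a : Fin k → ℕ, ((2 : ℝ) ^ (-(1 / 2) : ℝ)) ^ ∑ j, a j)
  refine ⟨Real.exp B, fun η hη i F => ?_⟩
  -- One prime sum at `1 + η` for each `j ≠ i`, hence the power `k - 1`; the remaining part `B` is
  -- independent of `η`.
  have h1 := (hasSum_sum fun j (_ : j ∈ Finset.univ.erase i) =>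
    hasSum_primes_single (by linarith : 1 < 1 + η) (natIndicator {i, j})).add
      (hasSum_primes_mul_pow_sum (k := k) (C := 2 ^ k * 2 ^ (2 : ℕ))
      (by norm_num : (1 : ℝ) < 1 + 1) (by positivity) (two_rpow_neg_lt_one one_half_pos))
  refine (sum_weighted_le (fun x => ?_) h1
    (fun p a ha => weightedCoeff_le_of_nonneg hr hη.le i p ha) F).trans ?_
  · refine add_nonneg (Finset.sum_nonneg fun j _ => ?_) (by positivity)
    split_ifs <;> positivity
  · rw [Real.exp_add, mul_comm, Finset.sum_const, Finset.card_erase_of_mem (Finset.mem_univ i),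
      Finset.card_univ, Fintype.card_fin, nsmul_eq_mul, Real.exp_nat_mul]
    gcongr
    exact exp_tsum_primes_rpow_le hη

theorem summable_lcmCoeff_div (i : Fin k) {r : ℝ} (hr : -1 < r) :
    Summable fun x : Nat.Primes × {a : Fin k → ℕ // a ≠ 0} =>
      |lcmCoeff k r x.1 x.2 * (1 / ((x.1 : ℕ) : ℝ)) ^ ∑ j, x.2.1 j| := by
  classical
  rcases le_total r 0 with h | h
  · have hθ : 0 < (r + 1) / 2 := by linarith
    exact summable_lcmCoeff_div_of_le hθ.le
      (hasSum_primes_mul_pow_sum (k := k) (C := 2 ^ k * 2 ^ (2 * ((r + 1) / 2)))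
        (by linarith : 1 < 1 + (r + 1) / 2) (by positivity) (two_rpow_neg_lt_one hθ))
      (fun p a ha => weightedCoeff_le_of_nonpos h rfl hθ i p ha)
  -- Here `η = 1`, so the weight `d_i ^ θ` is trivial.
  · exact summable_lcmCoeff_div_of_le (by norm_num : (0 : ℝ) ≤ 1 - 1)
      ((hasSum_sum fun j (_ : j ∈ Finset.univ.erase i) =>
        hasSum_primes_single (by norm_num : (1 : ℝ) < 1 + 1) (natIndicator {i, j})).add
          (hasSum_primes_mul_pow_sum (k := k) (C := 2 ^ k * 2 ^ (2 : ℕ))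
            (by norm_num : (1 : ℝ) < 1 + 1) (by positivity) (two_rpow_neg_lt_one one_half_pos)))
      (fun p a ha => weightedCoeff_le_of_nonneg h zero_le_one i p ha)

theorem prod_lcmCoeff_div (r : ℝ) (d : Nat.Primes →₀ (Fin k → ℕ)) :
    (d.prod fun p a => lcmCoeff k r p a * (1 / ((p : ℕ) : ℝ)) ^ ∑ j, a j) =
      d.prod (lcmCoeff k r) / ∏ i, (tupleOf d i : ℝ) := by
  have h2 : ∏ j, (tupleOf d j : ℝ) = ∏ p ∈ d.support, ((p : ℕ) : ℝ) ^ ∑ j, d p j := by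
    simp only [tupleOf, Finsupp.prod]
    push_cast
    rw [Finset.prod_comm]
    exact Finset.prod_congr rfl fun p _ => Finset.prod_pow_eq_pow_sum _ _ _
  rw [h2, Finsupp.prod, Finsupp.prod, ← Finset.prod_div_distrib]
  exact Finset.prod_congr rfl fun p _ => by rw [one_div, inv_pow, div_eq_mul_inv]

theorem summable_prod_lcmCoeff_div (i : Fin k) {r : ℝ} (hr : -1 < r) :
    Summable fun d : Nat.Primes →₀ (Fin k → ℕ) =>
      |d.prod (lcmCoeff k r)| / ∏ i, (tupleOf d i : ℝ) := by
  refine (summable_norm_finsupp_prod (w := fun p a =>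
    lcmCoeff k r p a * (1 / ((p : ℕ) : ℝ)) ^ ∑ j, a j) (summable_lcmCoeff_div i hr)).congr
      fun d => ?_
  rw [prod_lcmCoeff_div, abs_div, abs_of_pos (Finset.prod_pos fun i _ => by
    exact_mod_cast tupleOf_pos d i : 0 < ∏ i, (tupleOf d i : ℝ))]

/-- The excess is at most the sum, so the terms are dominated by powers of `max 1 (p ^ (-r)) / p`,
which is below `1` because `r > -1`. -/
theorem summable_excess_mul_pow {r : ℝ} (hr : -1 < r) (p : Nat.Primes) :
    Summable fun b : Fin k → ℕ =>
      (((p : ℕ) : ℝ) ^ (-r)) ^ excess b * (1 / ((p : ℕ) : ℝ)) ^ ∑ i, b i := by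
  have hp := prime_pos p
  have hp2 := two_le_prime p
  set y : ℝ := max 1 (((p : ℕ) : ℝ) ^ (-r))
  have hy : 1 ≤ y := le_max_left _ _
  have h1 : y * (1 / ((p : ℕ) : ℝ)) < 1 := by
    rw [mul_one_div, div_lt_one hp]
    refine max_lt (by linarith) ?_
    conv_rhs => rw [← Real.rpow_one ((p : ℕ) : ℝ)]
    exact Real.rpow_lt_rpow_of_exponent_lt (by linarith) (by linarith)
  refine (summable_pow_sum (k := k) (by positivity) h1).of_nonneg_of_le
    (fun b => by positivity) fun b => ?_
  rw [mul_pow]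
  gcongr
  calc (((p : ℕ) : ℝ) ^ (-r)) ^ excess b ≤ y ^ excess b := by gcongr; exact le_max_right _ _
    _ ≤ y ^ ∑ i, b i := pow_le_pow_right₀ hy (by have := excess_add_sup b; omega)

/-- The Euler factors of `lcmMomentConst r k`. -/
noncomputable def momentFactor (r : ℝ) (k : ℕ) (p : Nat.Primes) : ℝ :=
  (1 - 1 / ((p : ℕ) : ℝ)) ^ k *
    ∑' b : Fin k → ℕ, (((p : ℕ) : ℝ) ^ (-r)) ^ excess b * (1 / ((p : ℕ) : ℝ)) ^ ∑ i, b i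

theorem lcmMomentConst_eq (r : ℝ) (k : ℕ) :
    lcmMomentConst r k = ∏' p : Nat.Primes, momentFactor r k p := by
  unfold lcmMomentConst momentFactor
  refine tprod_congr fun p => ?_
  congr 1
  refine tsum_congr fun b => ?_
  have hp := prime_pos p
  have h1 : ((excess b : ℕ) : ℝ) + (Finset.univ.sup b : ℕ) = (∑ j, b j : ℕ) := by
    exact_mod_cast excess_add_sup b
  rw [← Real.rpow_sub hp, one_div, inv_pow, ← Real.rpow_natCast, ← Real.rpow_natCast,
    ← Real.rpow_mul hp.le, ← Real.rpow_neg hp.le, ← Real.rpow_add hp, ← h1]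
  congr 1
  ring

/-- The generating function of a mixed difference at `q = 1/p` produces the factor `(1 - 1/p) ^ k`.
-/
theorem hasProd_momentFactor (i : Fin k) {r : ℝ} (hr : -1 < r) :
    HasProd (momentFactor r k)
      (∑' d : Nat.Primes →₀ (Fin k → ℕ), d.prod (lcmCoeff k r) / ∏ i, (tupleOf d i : ℝ)) := by
  have h := hasProd_tsum_finsupp_prod (w := fun p a =>
    lcmCoeff k r p a * (1 / ((p : ℕ) : ℝ)) ^ ∑ j, a j)
    (fun p => by simp [lcmCoeff_zero]) (summable_lcmCoeff_div i hr)
  simp_rw [prod_lcmCoeff_div] at h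
  convert h using 2 with p
  exact (hasSum_mixedDiff _ _ (summable_excess_mul_pow hr p)).tsum_eq.symm

theorem tsum_lcmCoeff_div (i : Fin k) {r : ℝ} (hr : -1 < r) :
    ∑' d : Nat.Primes →₀ (Fin k → ℕ), d.prod (lcmCoeff k r) / ∏ i, (tupleOf d i : ℝ) =
      lcmMomentConst r k := by
  rw [lcmMomentConst_eq, (hasProd_momentFactor i hr).tprod_eq]

end GlobalBounds

/-! ### The asymptotic formulas -/

section Asymptotics

variable {k : ℕ}

theorem log_pow_le_mul_log_pow {m A x : ℕ} (hmA : m ≤ A) (hx : 2 ≤ x) :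
    Real.log x ^ m ≤ (1 / Real.log 2) ^ (A - m) * Real.log x ^ A := by
  have h2 : 0 < Real.log 2 := Real.log_pos one_lt_two
  have hx2 : Real.log 2 ≤ Real.log x := Real.log_le_log two_pos (by exact_mod_cast hx)
  have hlog : 0 < Real.log x := h2.trans_le hx2
  have h3 : 1 ≤ 1 / Real.log 2 * Real.log x := by
    rw [one_div, ← div_eq_inv_mul, one_le_div h2]
    exact hx2
  calc Real.log x ^ m ≤ (1 / Real.log 2 * Real.log x) ^ (A - m) * Real.log x ^ m :=
        le_mul_of_one_le_left (by positivity) (one_le_pow₀ h3)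
    _ = (1 / Real.log 2) ^ (A - m) * Real.log x ^ (A - m + m) := by rw [mul_pow, pow_add]; ring
    _ = _ := by rw [Nat.sub_add_cancel hmA]

/-- The errors actually obtained are converted to the stated ones; as `log x ≥ log 2`, a power of
`log x` may be raised at the cost of a constant. -/
theorem exists_log_pow_le (hk : 2 ≤ k) (r : ℝ) : ∃ L : ℝ, 0 ≤ L ∧ ∀ x : ℕ, 2 ≤ x →
    (r ≤ 0 → (x : ℝ) ^ (-((r + 1) / 2)) ≤ L * lcmMomentError r k x) ∧
    (0 < r → (x : ℝ) ^ (-1 : ℝ) * Real.log x ^ (k - 1) ≤ L * lcmMomentError r k x) := by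
  set A := max (2 ^ k - k - 1) (2 * k ^ 2 - k - 2)
  have hA : k - 1 ≤ A := by
    refine le_trans ?_ (le_max_right _ _)
    have : 2 * k ≤ k ^ 2 := by nlinarith
    omega
  have h2 : 0 < Real.log 2 := Real.log_pos one_lt_two
  rcases le_or_gt r 0 with hr | hr
  · refine ⟨(1 / Real.log 2) ^ A, by positivity, fun x hx => ⟨fun _ => ?_, fun h => ?_⟩⟩
    · have h := log_pow_le_mul_log_pow (Nat.zero_le A) hx
      rw [pow_zero, Nat.sub_zero] at h
      rw [lcmMomentError, if_pos (hr.trans zero_le_one), mul_left_comm]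
      exact le_mul_of_one_le_right (by positivity) h
    · linarith
  · rcases le_or_gt r 1 with hr1 | hr1
    · refine ⟨(1 / Real.log 2) ^ (A - (k - 1)), by positivity,
        fun x hx => ⟨fun h => by linarith, fun _ => ?_⟩⟩
      have hx1 : (1 : ℝ) ≤ x := by exact_mod_cast (by omega : 1 ≤ x)
      have hlog : 0 ≤ Real.log x := Real.log_nonneg hx1
      rw [lcmMomentError, if_pos hr1, mul_left_comm]
      exact mul_le_mul (Real.rpow_le_rpow_of_exponent_le hx1 (by linarith))
        (log_pow_le_mul_log_pow hA hx) (by positivity) (by positivity)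
    · refine ⟨1, zero_le_one, fun x hx => ⟨fun h => by linarith, fun _ => ?_⟩⟩
      rw [lcmMomentError, if_neg hr1.not_ge, one_mul]

/-- The condition `min 0 r ≤ t` ensures `θ ≤ t + 1` for `θ = (r + 1) / 2` when `r ≤ 0`, and for `θ =
1 - η` when `r > 0`. -/
theorem exists_abs_boxSum_sub_le (hk : 2 ≤ k) {r t : ℝ} (hr : -1 < r) (ht : -1 < t)
    (hrt : min 0 r ≤ t) : ∃ K : ℝ, ∀ x : ℕ, 2 ≤ x →
      |1 / (x : ℝ) ^ k * ∑ n ∈ boxTuples k x,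
        ((tupleLcm n : ℝ) / ∏ i, (n i : ℝ)) ^ r * ∏ i, ((n i : ℝ) / x) ^ t -
        lcmMomentConst r k / (t + 1) ^ k| ≤ K * lcmMomentError r k x := by
  have i₀ : Fin k := ⟨0, by omega⟩
  have hs := summable_prod_lcmCoeff_div i₀ hr
  obtain ⟨L, hL, hLx⟩ := exists_log_pow_le hk r
  set c : ℝ := Real.exp (k * max 1 (t + 1)) * max 1 (t + 1) * k with hc
  have hc0 : 0 ≤ c := by positivity
  have ht1 : 0 < t + 1 := by linarith
  rw [← tsum_lcmCoeff_div i₀ hr]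
  rcases le_or_gt r 0 with h0 | h0
  · rw [min_eq_right h0] at hrt
    obtain ⟨T, hT⟩ := exists_weighted_le_of_nonpos k hr h0
    have hT0 : 0 ≤ T := by simpa using hT i₀ ∅
    refine ⟨c * T / (t + 1) ^ k * L, fun x hx => ?_⟩
    have h := abs_boxSum_sub_le ht (by linarith : 0 ≤ (r + 1) / 2) (by linarith) (by linarith)
      (by omega : 0 < x) hs hT
    refine h.trans ?_
    rw [mul_assoc _ L]
    exact mul_le_mul_of_nonneg_left ((hLx x hx).1 h0) (by positivity)
  · rw [min_eq_left h0.le] at hrt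
    obtain ⟨C, hC⟩ := exists_weighted_le_of_nonneg k h0.le
    have hC0 : 0 ≤ C := by
      have := hC 1 one_pos i₀ ∅
      rw [Finset.sum_empty] at this
      exact nonneg_of_mul_nonneg_left this (by positivity)
    refine ⟨c * (C * 4 ^ (k - 1)) / (t + 1) ^ k * Real.exp (1 / 2) * L, fun x hx => ?_⟩
    have hx0 : (0 : ℝ) < x := by exact_mod_cast (by omega : 0 < x)
    have hlog : 1 / 2 ≤ Real.log x := by
      have := Real.log_le_log two_pos (by exact_mod_cast hx : (2 : ℝ) ≤ x)
      linarith [Real.log_two_gt_d9]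
    have hlog0 : 0 < Real.log x := by linarith
    -- This makes `x ^ η = exp (1/2)` and `1 + 1/η ≤ 4 log x`. The factor `2` keeps `η ≤ 1` down to
    -- `x = 2`, since `log 2 > 1/2`.
    set η := 1 / (2 * Real.log x) with hη
    have hη0 : 0 < η := by positivity
    have hη1 : η ≤ 1 := by
      rw [hη, div_le_one (by positivity)]
      linarith
    have h := abs_boxSum_sub_le ht (by linarith : 0 ≤ 1 - η) (by linarith) (by linarith)
      (by omega : 0 < x) hs (hC η hη0)
    have h1 : (1 + 1 / η) ^ (k - 1) ≤ 4 ^ (k - 1) * Real.log x ^ (k - 1) := by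
      rw [← mul_pow, hη, one_div_one_div]
      exact pow_le_pow_left₀ (by positivity) (by linarith) _
    have h2 : (x : ℝ) ^ (-(1 - η)) = (x : ℝ) ^ (-1 : ℝ) * Real.exp (1 / 2) := by
      rw [neg_sub, sub_eq_neg_add, Real.rpow_add hx0, Real.rpow_def_of_pos hx0 η, hη]
      congr 2
      field_simp
    rw [h2] at h
    refine h.trans ?_
    calc _ ≤ c * (C * (4 ^ (k - 1) * Real.log x ^ (k - 1))) / (t + 1) ^ k *
          ((x : ℝ) ^ (-1 : ℝ) * Real.exp (1 / 2)) := by gcongr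
      _ = c * (C * 4 ^ (k - 1)) / (t + 1) ^ k * Real.exp (1 / 2) *
          ((x : ℝ) ^ (-1 : ℝ) * Real.log x ^ (k - 1)) := by ring
      _ ≤ c * (C * 4 ^ (k - 1)) / (t + 1) ^ k * Real.exp (1 / 2) *
          (L * lcmMomentError r k x) :=
        mul_le_mul_of_nonneg_left ((hLx x hx).2 h0) (by positivity)
      _ = _ := by ring

theorem lcm_ratio_mul_rpow (r : ℝ) {x : ℕ} {n : Fin k → ℕ} (hn : ∀ i, n i ≠ 0) :
    ((tupleLcm n : ℝ) / ∏ i, (n i : ℝ)) ^ r * ∏ i, ((n i : ℝ) / x) ^ r =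
      ((tupleLcm n : ℝ) / (x : ℝ) ^ k) ^ r := by
  have hpos : ∏ i, (n i : ℝ) ≠ 0 :=
    Finset.prod_ne_zero_iff.2 fun i _ => Nat.cast_ne_zero.2 (hn i)
  rw [Real.finsetProd_rpow _ _ fun i _ => by positivity,
    ← Real.mul_rpow (by positivity) (Finset.prod_nonneg fun i _ => by positivity),
    Finset.prod_div_distrib, Finset.prod_const, Finset.card_univ, Fintype.card_fin]
  congr 1
  field_simp

theorem lcmMoment_asymptotics (hk : 2 ≤ k) {r : ℝ} (hr : -1 < r) :
    ∃ K : ℝ, ∀ x : ℕ, 2 ≤ x →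
      |(1 / (x : ℝ) ^ k * ∑ n ∈ boxTuples k x, ((tupleLcm n : ℝ) / (x : ℝ) ^ k) ^ r)
          - lcmMomentConst r k / (r + 1) ^ k| ≤ K * lcmMomentError r k x ∧
      |(1 / (x : ℝ) ^ k * ∑ n ∈ boxTuples k x, ((tupleLcm n : ℝ) / ∏ i, (n i : ℝ)) ^ r)
          - lcmMomentConst r k| ≤ K * lcmMomentError r k x := by
  -- The weight `t = r` turns the denominator `∏ n_i` into `x ^ k`; with `t = 0` the weight is `1`.
  obtain ⟨K₁, h₁⟩ := exists_abs_boxSum_sub_le hk hr hr (min_le_right _ _)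
  obtain ⟨K₂, h₂⟩ := exists_abs_boxSum_sub_le hk (t := 0) hr (by norm_num) (min_le_left _ _)
  refine ⟨max K₁ K₂, fun x hx => ?_⟩
  have hE : 0 ≤ lcmMomentError r k x := by
    have hlog : 0 ≤ Real.log x := Real.log_natCast_nonneg x
    unfold lcmMomentError
    split_ifs <;> positivity
  constructor
  · have h := (h₁ x hx).trans (mul_le_mul_of_nonneg_right (le_max_left K₁ K₂) hE)
    rwa [Finset.sum_congr rfl fun n hn => lcm_ratio_mul_rpow r fun i =>
      Nat.one_le_iff_ne_zero.1 (mem_boxTuples.1 hn i).1] at h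
  · have h := (h₂ x hx).trans (mul_le_mul_of_nonneg_right (le_max_right K₁ K₂) hE)
    simpa using h

end Asymptotics

/-! ### Expectations as averages over the box -/

section Expectations

variable {k : ℕ}

theorem integral_uniformTupleLaw {x : ℕ} (hx : 1 ≤ x) (F : (Fin k → ℕ) → ℝ) :
    ∫ n, F n ∂(uniformTupleLaw k x) = 1 / (x : ℝ) ^ k * ∑ n ∈ boxTuples k x, F n := by
  have hx0 : (x : ℝ) ≠ 0 := by exact_mod_cast (by omega : x ≠ 0)
  have : IsProbabilityMeasure (uniformOn (Set.Icc 1 x) : Measure ℕ) :=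
    isProbabilityMeasure_uniformOn (Set.finite_Icc 1 x) ⟨1, by simp [hx]⟩
  have h1 : ∀ m ∈ Finset.Icc 1 x, (uniformOn (Set.Icc 1 x) : Measure ℕ) {m} = (x : ENNReal)⁻¹ := by
    intro m hm
    have h := uniformOn_apply_finset (s := Finset.Icc 1 x) (t := {m})
    rw [Finset.inter_singleton_of_mem hm] at h
    simpa using h
  have h2 : ∀ n ∈ boxTuples k x, (uniformTupleLaw k x).real {n} = 1 / (x : ℝ) ^ k := by
    intro n hn
    rw [measureReal_def, uniformTupleLaw, Measure.pi_singleton,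
      Finset.prod_congr rfl fun i _ => h1 (n i) (Fintype.mem_piFinset.1 hn i)]
    simp
  have h3 : ∀ᵐ n ∂(uniformTupleLaw k x), n ∈ (boxTuples k x : Set (Fin k → ℕ)) := by
    have h4 : ∀ i : Fin k, ∀ᵐ n ∂(uniformTupleLaw k x), n i ∈ Set.Icc 1 x := fun i =>
      Measure.tendsto_eval_ae_ae.eventually (by
        have := uniformOn_self (Set.finite_Icc 1 x) ⟨1, by simp [hx]⟩
        rw [← prob_compl_eq_zero_iff (Set.finite_Icc 1 x).measurableSet] at this
        exact this)
    filter_upwards [ae_all_iff.2 h4] with n hn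
    exact mem_boxTuples.2 hn
  have hprob : IsProbabilityMeasure (uniformTupleLaw k x) := by
    unfold uniformTupleLaw; infer_instance
  rw [← Measure.restrict_eq_self_of_ae_mem h3, setIntegral_finset _ IntegrableOn.finset,
    Finset.mul_sum]
  exact Finset.sum_congr rfl fun n hn => by rw [h2 n hn, smul_eq_mul]

theorem integral_lcm_div_pow (r : ℝ) {x : ℕ} (hx : 1 ≤ x) :
    ∫ n, (tupleLcm n : ℝ) ^ r / (x : ℝ) ^ ((k : ℝ) * r) ∂(uniformTupleLaw k x) =
      1 / (x : ℝ) ^ k * ∑ n ∈ boxTuples k x, ((tupleLcm n : ℝ) / (x : ℝ) ^ k) ^ r := by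
  rw [integral_uniformTupleLaw hx]
  congr 1
  refine Finset.sum_congr rfl fun n _ => ?_
  rw [Real.div_rpow (by positivity) (by positivity), Real.rpow_mul (by positivity),
    Real.rpow_natCast]

theorem integral_lcm_div_prod (r : ℝ) {x : ℕ} (hx : 1 ≤ x) :
    ∫ n, (tupleLcm n : ℝ) ^ r / (∏ i, (n i : ℝ)) ^ r ∂(uniformTupleLaw k x) =
      1 / (x : ℝ) ^ k * ∑ n ∈ boxTuples k x, ((tupleLcm n : ℝ) / ∏ i, (n i : ℝ)) ^ r := by
  rw [integral_uniformTupleLaw hx]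
  congr 1
  refine Finset.sum_congr rfl fun n _ => ?_
  rw [Real.div_rpow (by positivity) (Finset.prod_nonneg fun i _ => by positivity)]

end Expectations

/-! ### The law of the excess at one prime -/

section LocalLaw

variable {k : ℕ}

instance isProbabilityMeasure_geomLaw (p : Nat.Primes) : IsProbabilityMeasure (geomLaw p) := by
  unfold geomLaw; infer_instance

theorem geomLaw_real_singleton (p : Nat.Primes) (m : ℕ) :
    (geomLaw p).real {m} = (1 / ((p : ℕ) : ℝ)) ^ m * (1 - 1 / ((p : ℕ) : ℝ)) := by
  unfold geomLaw
  rw [geometricMeasure_real_singleton]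
  · simp
  · have h : 1 / ((p : ℕ) : ℝ) < 1 := by
      rw [div_lt_one (prime_pos p)]
      linarith [two_le_prime p]
    intro hc
    have := congrArg Subtype.val hc
    simp only [Set.Icc.coe_zero] at this
    linarith

theorem pi_geomLaw_real_singleton (p : Nat.Primes) (a : Fin k → ℕ) :
    (Measure.pi fun _ : Fin k => geomLaw p).real {a} =
      (1 - 1 / ((p : ℕ) : ℝ)) ^ k * (1 / ((p : ℕ) : ℝ)) ^ ∑ i, a i := by
  rw [measureReal_def, Measure.pi_singleton, ENNReal.toReal_prod]
  simp only [← measureReal_def, geomLaw_real_singleton]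
  rw [Finset.prod_mul_distrib, Finset.prod_pow_eq_pow_sum, Finset.prod_const, Finset.card_univ,
    Fintype.card_fin, mul_comm]

/-- The sum of `ρ ^ (a₁ + ⋯ + a_k)` over the tuples `a` of excess `v`. -/
noncomputable def excessSum (k : ℕ) (ρ : ℝ) (v : ℕ) : ℝ :=
  ∑' a : (excess : (Fin k → ℕ) → ℕ) ⁻¹' {v}, ρ ^ ∑ i, a.1 i

theorem pi_geomLaw_real_excess (p : Nat.Primes) (v : ℕ) :
    (Measure.pi fun _ : Fin k => geomLaw p).real (excess ⁻¹' {v}) =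
      (1 - 1 / ((p : ℕ) : ℝ)) ^ k * excessSum k (1 / ((p : ℕ) : ℝ)) v := by
  have h1 := setIntegral_countable (μ := Measure.pi fun _ : Fin k => geomLaw p)
    (fun _ => (1 : ℝ)) (Set.to_countable ((excess : (Fin k → ℕ) → ℕ) ⁻¹' {v}))
    (integrable_const _).integrableOn
  rw [setIntegral_const] at h1
  simp only [smul_eq_mul, mul_one, pi_geomLaw_real_singleton] at h1
  rw [h1, tsum_mul_left, excessSum]

theorem excessSum_nonneg {ρ : ℝ} (h0 : 0 ≤ ρ) (v : ℕ) : 0 ≤ excessSum k ρ v :=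
  tsum_nonneg fun _ => by positivity

theorem summable_excessSum {ρ : ℝ} (h0 : 0 ≤ ρ) (h1 : ρ < 1) : Summable (excessSum k ρ) :=
  ((summable_pow_sum (k := k) h0 h1).hasSum.tsum_fiberwise excess).summable

theorem one_le_excessSum_zero {ρ : ℝ} (h0 : 0 ≤ ρ) (h1 : ρ < 1) : 1 ≤ excessSum k ρ 0 := by
  have h := ((summable_pow_sum (k := k) h0 h1).subtype (excess ⁻¹' {0})).le_tsum
    ⟨0, excess_zero⟩ fun _ _ => by simp only [Function.comp]; positivity
  simp only [Function.comp, Pi.zero_apply, Finset.sum_const_zero, pow_zero] at h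
  exact h

theorem one_div_prime_lt_one (p : Nat.Primes) : 1 / ((p : ℕ) : ℝ) < 1 := by
  rw [div_lt_one (prime_pos p)]
  linarith [two_le_prime p]

theorem hasSum_excessSum_mul_pow {r : ℝ} (hr : -1 < r) (p : Nat.Primes) :
    HasSum (fun v => excessSum k (1 / ((p : ℕ) : ℝ)) v * (((p : ℕ) : ℝ) ^ (-r)) ^ v)
      (∑' b : Fin k → ℕ, (((p : ℕ) : ℝ) ^ (-r)) ^ excess b * (1 / ((p : ℕ) : ℝ)) ^ ∑ i, b i) := by
  refine ((summable_excess_mul_pow hr p).hasSum.tsum_fiberwise excess).congr_fun fun v => ?_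
  rw [excessSum, ← tsum_mul_right]
  refine tsum_congr fun a => ?_
  have ha : excess a.1 = v := a.2
  rw [ha, mul_comm]

/-- A nonzero excess `v` comes with a maximum `M ≥ 1` and total `v + M`, so the exponent is `-(1 +
r)v - M`. With `κ ≤ min 1 (1 + r)` it is at most `-(1 + κ) - κ(v + M - 2)`. -/
theorem excessSum_mul_pow_le {r κ : ℝ} (hκ0 : 0 < κ) (hκ1 : κ ≤ 1) (hκr : κ ≤ 1 + r)
    (p : Nat.Primes) {v : ℕ} (hv : v ≠ 0) :
    excessSum k (1 / ((p : ℕ) : ℝ)) v * (((p : ℕ) : ℝ) ^ (-r)) ^ v ≤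
      2 ^ (2 * κ) * (((p : ℕ) : ℝ) ^ (-(1 + κ)) * excessSum k ((2 : ℝ) ^ (-κ)) v) := by
  have hp := prime_pos p
  have hp2 := two_le_prime p
  have hs1 := (summable_pow_sum (k := k) (by positivity : 0 ≤ 1 / ((p : ℕ) : ℝ))
    (one_div_prime_lt_one p)).subtype (excess ⁻¹' {v})
  have hs2 := (summable_pow_sum (k := k) (by positivity) (two_rpow_neg_lt_one hκ0)).subtype
    (excess ⁻¹' {v})
  rw [excessSum, excessSum, ← tsum_mul_right, ← tsum_mul_left, ← tsum_mul_left]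
  refine Summable.tsum_le_tsum (fun a => ?_) (hs1.mul_right _) ((hs2.mul_left _).mul_left _)
  obtain ⟨a, ha⟩ := a
  have ha : excess a = v := ha
  have ha0 : a ≠ 0 := by
    rintro rfl
    exact hv (ha.symm.trans excess_zero)
  have h1 : (v : ℝ) + (Finset.univ.sup a : ℕ) = (∑ j, a j : ℕ) := by
    rw [← ha]
    exact_mod_cast excess_add_sup a
  have h2 : (1 : ℝ) ≤ (Finset.univ.sup a : ℕ) := by exact_mod_cast one_le_sup ha0
  have h3 : (1 : ℝ) ≤ v := by exact_mod_cast Nat.one_le_iff_ne_zero.2 hv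
  simp only
  set M : ℝ := ((Finset.univ.sup a : ℕ) : ℝ)
  set N : ℕ := ∑ j, a j
  calc (1 / ((p : ℕ) : ℝ)) ^ N * (((p : ℕ) : ℝ) ^ (-r)) ^ v
      = ((p : ℕ) : ℝ) ^ (-(N : ℝ) + -r * v) := by
        rw [Real.rpow_add hp, Real.rpow_neg hp.le (N : ℝ), Real.rpow_natCast,
          Real.rpow_mul hp.le, Real.rpow_natCast, one_div, inv_pow]
    _ ≤ ((p : ℕ) : ℝ) ^ (-(1 + κ) + -κ * (N - 2)) := by
        refine Real.rpow_le_rpow_of_exponent_le (by linarith) ?_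
        rw [← h1]
        nlinarith [mul_nonneg (sub_nonneg.2 hκ1) (sub_nonneg.2 h2),
          mul_nonneg (sub_nonneg.2 hκr) (by linarith : (0 : ℝ) ≤ v)]
    _ = ((p : ℕ) : ℝ) ^ (-(1 + κ)) * ((p : ℕ) : ℝ) ^ (-κ * (N - 2)) := by
        rw [Real.rpow_add hp]
    _ ≤ ((p : ℕ) : ℝ) ^ (-(1 + κ)) * (2 : ℝ) ^ (-κ * (N - 2)) := by
        have h5 : -κ * ((N : ℝ) - 2) ≤ 0 := by
          rw [← h1]; nlinarith
        exact mul_le_mul_of_nonneg_left (Real.rpow_le_rpow_of_nonpos two_pos hp2 h5)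
          (by positivity)
    _ = _ := by
        have : -κ * ((N : ℝ) - 2) = 2 * κ + -κ * N := by ring
        rw [this, Real.rpow_add two_pos, Real.rpow_mul two_pos.le (-κ), Real.rpow_natCast]
        ring

/-- The law of the excess at `p`, normalized to be `1` at `0` and weighted by `p ^ (-r v)`. -/
noncomputable def normalizedLaw (k : ℕ) (r : ℝ) (p : Nat.Primes) (v : ℕ) : ℝ :=
  excessSum k (1 / ((p : ℕ) : ℝ)) v / excessSum k (1 / ((p : ℕ) : ℝ)) 0 *
    (((p : ℕ) : ℝ) ^ (-r)) ^ v

theorem excessSum_zero_pos (k : ℕ) (p : Nat.Primes) : 0 < excessSum k (1 / ((p : ℕ) : ℝ)) 0 :=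
  one_pos.trans_le (one_le_excessSum_zero (by have := prime_pos p; positivity)
    (one_div_prime_lt_one p))

theorem normalizedLaw_zero (r : ℝ) (p : Nat.Primes) : normalizedLaw k r p 0 = 1 := by
  rw [normalizedLaw, pow_zero, mul_one, div_self (excessSum_zero_pos k p).ne']

theorem normalizedLaw_nonneg (r : ℝ) (p : Nat.Primes) (v : ℕ) : 0 ≤ normalizedLaw k r p v := by
  have hp := prime_pos p
  have h1 := excessSum_nonneg (k := k) (by positivity : 0 ≤ 1 / ((p : ℕ) : ℝ)) v
  have h2 := excessSum_zero_pos k p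
  unfold normalizedLaw
  positivity

theorem summable_normalizedLaw {r : ℝ} (hr : -1 < r) :
    Summable fun x : Nat.Primes × {v : ℕ // v ≠ 0} => |normalizedLaw k r x.1 x.2| := by
  set κ := min 1 (1 + r)
  have hκ0 : 0 < κ := lt_min one_pos (by linarith)
  have h1 : Summable fun x : Nat.Primes × ℕ =>
      ((x.1 : ℕ) : ℝ) ^ (-(1 + κ)) * excessSum k ((2 : ℝ) ^ (-κ)) x.2 :=
    Summable.mul_of_nonneg (f := fun p : Nat.Primes => ((p : ℕ) : ℝ) ^ (-(1 + κ)))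
      (summable_primes_rpow (by linarith))
      (summable_excessSum (by positivity) (two_rpow_neg_lt_one hκ0))
      (fun p => by positivity) (excessSum_nonneg (by positivity))
  have h2 : Summable fun x : Nat.Primes × {v : ℕ // v ≠ 0} =>
      2 ^ (2 * κ) * (((x.1 : ℕ) : ℝ) ^ (-(1 + κ)) * excessSum k ((2 : ℝ) ^ (-κ)) x.2.1) := by
    refine (h1.mul_left (2 ^ (2 * κ))).comp_injective
      (i := fun x : Nat.Primes × {v : ℕ // v ≠ 0} => (x.1, x.2.1)) ?_
    rintro ⟨p, a, ha⟩ ⟨q, b, hb⟩ hab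
    simpa using hab
  refine h2.of_nonneg_of_le (fun _ => abs_nonneg _) fun x => ?_
  refine le_trans ?_ (excessSum_mul_pow_le hκ0 (min_le_left _ _) (min_le_right _ _) x.1 x.2.2)
  have hp := prime_pos x.1
  rw [abs_of_nonneg (normalizedLaw_nonneg _ _ _), normalizedLaw]
  refine mul_le_mul_of_nonneg_right (div_le_self (excessSum_nonneg (by positivity) _) ?_)
    (by positivity)
  exact one_le_excessSum_zero (by positivity) (one_div_prime_lt_one x.1)

/-- Grouping exponent vectors by excess writes the Euler factor as the expectation of `p ^ (-r e)`;
the probability of excess `0` is then factored out. -/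
theorem momentFactor_eq {r : ℝ} (hr : -1 < r) (p : Nat.Primes) :
    momentFactor r k p = (Measure.pi fun _ : Fin k => geomLaw p).real (excess ⁻¹' {0}) *
      ∑' v, normalizedLaw k r p v := by
  have h1 := excessSum_zero_pos k p
  have h2 : ∑' v, normalizedLaw k r p v = (excessSum k (1 / ((p : ℕ) : ℝ)) 0)⁻¹ *
      ∑' v, excessSum k (1 / ((p : ℕ) : ℝ)) v * (((p : ℕ) : ℝ) ^ (-r)) ^ v := by
    rw [← tsum_mul_left]
    refine tsum_congr fun v => ?_
    rw [normalizedLaw]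
    ring
  rw [momentFactor, pi_geomLaw_real_excess, h2, (hasSum_excessSum_mul_pow hr p).tsum_eq]
  field_simp

end LocalLaw

/-! ### Positive integers as prime exponent functions -/

section PrimeExponents

/-- The positive integer with the prime exponents `d`. -/
def natOfExponents (d : Nat.Primes →₀ ℕ) : ℕ := d.prod fun p a => (p : ℕ) ^ a

theorem natOfExponents_pos (d : Nat.Primes →₀ ℕ) : 0 < natOfExponents d :=
  Finset.prod_pos fun p _ => pow_pos p.2.pos _

theorem factorization_natOfExponents (d : Nat.Primes →₀ ℕ) (q : Nat.Primes) :
    (natOfExponents d).factorization q = d q := by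
  classical
  rw [natOfExponents, Finsupp.prod, Nat.factorization_prod_apply fun p _ =>
    pow_ne_zero _ p.2.ne_zero]
  rw [Finset.sum_eq_single q]
  · rw [q.2.factorization_pow, Finsupp.single_eq_same]
  · intro p _ hpq
    rw [p.2.factorization_pow, Finsupp.single_eq_of_ne]
    exact fun h => hpq (Subtype.ext h.symm)
  · intro hq
    rw [Finsupp.notMem_support_iff.1 hq]
    simp

theorem eq_of_factorization_primes {m n : ℕ} (hm : m ≠ 0) (hn : n ≠ 0)
    (h : ∀ p : Nat.Primes, m.factorization p = n.factorization p) : m = n := by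
  refine Nat.eq_of_factorization_eq hm hn fun p => ?_
  by_cases hp : p.Prime
  · exact h ⟨p, hp⟩
  · rw [Nat.factorization_eq_zero_of_not_prime _ hp, Nat.factorization_eq_zero_of_not_prime _ hp]

theorem exists_natOfExponents_eq {n : ℕ} (hn : n ≠ 0) : ∃ d, natOfExponents d = n :=
  ⟨n.factorization.comapDomain (fun p : Nat.Primes => (p : ℕ)) Subtype.val_injective.injOn,
    eq_of_factorization_primes (natOfExponents_pos _).ne' hn fun p => by
      rw [factorization_natOfExponents]
      rfl⟩

/-- Unique factorization, as an equivalence. -/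
noncomputable def exponentsEquiv : (Nat.Primes →₀ ℕ) ≃ ℕ+ :=
  Equiv.ofBijective (fun d => ⟨natOfExponents d, natOfExponents_pos d⟩) <| by
    constructor
    · intro d d' h
      have h' : natOfExponents d = natOfExponents d' := congrArg Subtype.val h
      ext p
      rw [← factorization_natOfExponents, h', factorization_natOfExponents]
    · intro n
      obtain ⟨d, hd⟩ := exists_natOfExponents_eq n.ne_zero
      exact ⟨d, Subtype.ext hd⟩

theorem coe_exponentsEquiv (d : Nat.Primes →₀ ℕ) : (exponentsEquiv d : ℕ) = natOfExponents d :=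
  rfl

end PrimeExponents

/-! ### The law of `R_k` and its Dirichlet series -/

section LcmRatio

variable {k : ℕ}

theorem hasProd_zero_of_infinite {e : Nat.Primes → ℕ} (he : {p | e p ≠ 0}.Infinite) :
    HasProd (fun p : Nat.Primes => (((p : ℕ) : ℝ) ^ e p)⁻¹) 0 := by
  classical
  have h0 : ∀ p : Nat.Primes, 0 ≤ (((p : ℕ) : ℝ) ^ e p)⁻¹ := fun p => by positivity
  have h1 : ∀ p : Nat.Primes, (((p : ℕ) : ℝ) ^ e p)⁻¹ ≤ 1 := fun p =>
    inv_le_one_of_one_le₀ (one_le_pow₀ (by linarith [two_le_prime p]))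
  have h2 : ∀ p ∈ {p | e p ≠ 0}, (((p : ℕ) : ℝ) ^ e p)⁻¹ ≤ 1 / 2 := by
    intro p hp
    rw [one_div]
    refine inv_anti₀ two_pos ?_
    calc (2 : ℝ) ≤ (p : ℕ) := two_le_prime p
      _ = ((p : ℕ) : ℝ) ^ 1 := (pow_one _).symm
      _ ≤ _ := pow_le_pow_right₀ (by linarith [two_le_prime p]) (Nat.one_le_iff_ne_zero.2 hp)
  refine Metric.tendsto_nhds.2 fun ε hε => ?_
  obtain ⟨M, hM⟩ := exists_pow_lt_of_lt_one hε one_half_lt_one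
  obtain ⟨T, hT, hTM⟩ := he.exists_subset_card_eq M
  filter_upwards [Filter.eventually_ge_atTop T] with S hS
  rw [Real.dist_0_eq_abs, abs_of_nonneg (Finset.prod_nonneg fun p _ => h0 p)]
  refine lt_of_le_of_lt ?_ hM
  calc ∏ p ∈ S, (((p : ℕ) : ℝ) ^ e p)⁻¹ ≤ ∏ p ∈ T, (((p : ℕ) : ℝ) ^ e p)⁻¹ := by
        rw [← Finset.prod_sdiff hS]
        exact mul_le_of_le_one_left (Finset.prod_nonneg fun p _ => h0 p)
          (Finset.prod_le_one (fun p _ => h0 p) fun p _ => h1 p)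
    _ ≤ ∏ _p ∈ T, (1 / 2 : ℝ) := Finset.prod_le_prod (fun p _ => h0 p) fun p hp => h2 p (hT hp)
    _ = (1 / 2) ^ M := by rw [Finset.prod_const, hTM]

theorem lcmRatioVar_eq (ω : Nat.Primes → Fin k → ℕ) :
    lcmRatioVar k ω = ∏' p : Nat.Primes, (((p : ℕ) : ℝ) ^ excess (ω p))⁻¹ := by
  unfold lcmRatioVar
  refine tprod_congr fun p => ?_
  have h : ((Finset.univ.sup (ω p) : ℕ) : ℤ) - ((∑ j, ω p j : ℕ) : ℤ) = -(excess (ω p) : ℤ) := by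
    have := excess_add_sup (ω p)
    omega
  rw [h, zpow_neg, zpow_natCast]

/-- If finitely many primes have positive excess, the product is the reciprocal of an integer and
unique factorization applies. Otherwise it is `0`, hence not `1/n`. -/
theorem lcmRatioVar_eq_one_div_iff (ω : Nat.Primes → Fin k → ℕ) {n : ℕ} (hn : n ≠ 0) :
    lcmRatioVar k ω = 1 / (n : ℝ) ↔ ∀ p : Nat.Primes, excess (ω p) = n.factorization p := by
  rw [lcmRatioVar_eq]
  by_cases hfin : {p : Nat.Primes | excess (ω p) ≠ 0}.Finite
  · set d : Nat.Primes →₀ ℕ := Finsupp.ofSupportFinite (fun p => excess (ω p)) hfin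
    have hd : ∀ p, d p = excess (ω p) := fun _ => rfl
    have h1 : ∏' p : Nat.Primes, (((p : ℕ) : ℝ) ^ excess (ω p))⁻¹ =
        1 / (natOfExponents d : ℝ) := by
      rw [tprod_eq_prod (s := d.support), Finset.prod_inv_distrib, natOfExponents, Finsupp.prod,
        one_div]
      · push_cast
        rfl
      · intro p hp
        rw [← hd, Finsupp.notMem_support_iff.1 hp, pow_zero, inv_one]
    rw [h1]
    simp only [one_div, inv_inj, Nat.cast_inj, ← hd, ← factorization_natOfExponents]
    exact ⟨fun h p => by rw [h], eq_of_factorization_primes (natOfExponents_pos d).ne' hn⟩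
  -- Genuine convergence to `0` matters: a divergent `∏'` would take the default value `1`, which is
  -- `1/n` for `n = 1`.
  · rw [(hasProd_zero_of_infinite hfin).tprod_eq]
    constructor
    · intro h
      have : (1 : ℝ) / n ≠ 0 := one_div_ne_zero (Nat.cast_ne_zero.2 hn)
      exact absurd h.symm this
    · intro h
      refine absurd ?_ hfin
      simp only [h]
      exact (n.factorization.hasFiniteSupport.preimage
        (f := fun p : Nat.Primes => (p : ℕ)) Subtype.val_injective.injOn)

/-- The event is a product of local events, so independence gives a product of probabilities. The
factors are at most `1`, so the partial products decrease to their infimum. -/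
theorem hasProd_lcmRatioProb {n : ℕ} (hn : n ≠ 0) :
    HasProd (fun p : Nat.Primes =>
      (Measure.pi fun _ : Fin k => geomLaw p).real (excess ⁻¹' {n.factorization p}))
      (lcmRatioProb k n) := by
  have h1 : {ω : Nat.Primes → Fin k → ℕ | lcmRatioVar k ω = 1 / (n : ℝ)} =
      Set.univ.pi fun p : Nat.Primes => excess ⁻¹' {n.factorization p} := by
    ext ω
    simp only [Set.mem_ofPred_eq, lcmRatioVar_eq_one_div_iff ω hn, Set.mem_pi, Set.mem_univ,
      true_implies, Set.mem_preimage, Set.mem_singleton_iff]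
  have h2 : geomFamilyLaw k {ω : Nat.Primes → Fin k → ℕ | lcmRatioVar k ω = 1 / (n : ℝ)} =
      ∏' p : Nat.Primes,
        (Measure.pi fun _ : Fin k => geomLaw p) (excess ⁻¹' {n.factorization p}) := by
    rw [h1, geomFamilyLaw, Measure.infinitePi_pi_univ]
    exact fun p => (Set.to_countable _).measurableSet
  have h3 : HasProd (fun p : Nat.Primes =>
      (Measure.pi fun _ : Fin k => geomLaw p) (excess ⁻¹' {n.factorization p}))
      (∏' p : Nat.Primes,
        (Measure.pi fun _ : Fin k => geomLaw p) (excess ⁻¹' {n.factorization p})) := by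
    rw [ENNReal.tprod_eq_iInf_prod fun _ => prob_le_one]
    exact tendsto_atTop_iInf (Finset.prod_anti_set_of_le_one' fun _ => prob_le_one)
  rw [lcmRatioProb, measureReal_def, h2]
  have hne : ∏' p : Nat.Primes,
      (Measure.pi fun _ : Fin k => geomLaw p) (excess ⁻¹' {n.factorization p}) ≠ ⊤ := by
    rw [← h2]
    have : IsProbabilityMeasure (geomFamilyLaw k) := by unfold geomFamilyLaw; infer_instance
    exact measure_ne_top _ _
  refine ((ENNReal.tendsto_toReal hne).comp h3).congr fun S => ?_
  simp only [Function.comp, ENNReal.toReal_prod]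
  rfl

/-- The products for `n` and for `1` differ only at the primes dividing `n`. Factoring out `p_k(1)`
makes the local weights equal to `1` at exponent `0`, as the Euler product over finitely supported
functions requires. -/
theorem rpow_mul_lcmRatioProb (r : ℝ) (d : Nat.Primes →₀ ℕ) :
    (natOfExponents d : ℝ) ^ (-r) * lcmRatioProb k (natOfExponents d) =
      lcmRatioProb k 1 * d.prod (normalizedLaw k r) := by
  have h1 := hasProd_lcmRatioProb (k := k) (natOfExponents_pos d).ne'
  have h2 := (hasProd_lcmRatioProb (k := k) one_ne_zero).mul
    (hasProd_prod_of_ne_finset_one (s := d.support) (f := fun p : Nat.Primes =>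
      excessSum k (1 / ((p : ℕ) : ℝ)) (d p) / excessSum k (1 / ((p : ℕ) : ℝ)) 0) fun p hp => by
        rw [Finsupp.notMem_support_iff.1 hp, div_self (excessSum_zero_pos k p).ne'])
  have h3 : lcmRatioProb k (natOfExponents d) = lcmRatioProb k 1 *
      ∏ p ∈ d.support, excessSum k (1 / ((p : ℕ) : ℝ)) (d p) /
        excessSum k (1 / ((p : ℕ) : ℝ)) 0 := by
    refine h1.unique (h2.congr_fun fun p => ?_)
    rw [factorization_natOfExponents, pi_geomLaw_real_excess, Nat.factorization_one,
      Finsupp.zero_apply, pi_geomLaw_real_excess]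
    have := (excessSum_zero_pos k p).ne'
    field_simp
  have h4 : (natOfExponents d : ℝ) ^ (-r) = ∏ p ∈ d.support, (((p : ℕ) : ℝ) ^ (-r)) ^ d p := by
    rw [natOfExponents, Finsupp.prod]
    push_cast
    rw [← Real.finsetProd_rpow _ _ fun p _ => by positivity]
    refine Finset.prod_congr rfl fun p _ => ?_
    have hp := (prime_pos p).le
    rw [← Real.rpow_natCast, ← Real.rpow_mul hp, mul_comm, Real.rpow_mul hp, Real.rpow_natCast]
  rw [h3, h4, mul_left_comm, ← Finset.prod_mul_distrib, Finsupp.prod]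
  congr 1
  exact Finset.prod_congr rfl fun p _ => by rw [normalizedLaw, mul_comm]

theorem hasSum_rpow_mul_lcmRatioProb {r : ℝ} (hr : -1 < r) :
    HasSum (fun n : ℕ+ => ((n : ℕ) : ℝ) ^ (-r) * lcmRatioProb k n) (lcmMomentConst r k) := by
  have hs := summable_normalizedLaw (k := k) hr
  have h1 := hasProd_tsum_finsupp_prod (normalizedLaw_zero r) hs
  have h2 : HasProd (momentFactor r k)
      (lcmRatioProb k 1 * ∑' d : Nat.Primes →₀ ℕ, d.prod (normalizedLaw k r)) := by
    refine ((hasProd_lcmRatioProb (k := k) one_ne_zero).mul h1).congr_fun fun p => ?_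
    rw [momentFactor_eq hr, Nat.factorization_one, Finsupp.zero_apply]
  rw [lcmMomentConst_eq, h2.tprod_eq, ← exponentsEquiv.hasSum_iff]
  refine ((summable_norm_finsupp_prod hs).of_abs.hasSum.mul_left _).congr_fun fun d => ?_
  rw [Function.comp, coe_exponentsEquiv, rpow_mul_lcmRatioProb]

end LcmRatio

theorem theorem1p2 (k : ℕ) (hk : 2 ≤ k) (r : ℝ) (hr : -1 < r) :
    -- the Dirichlet series for `C_{r,k}`
    HasSum (fun n : ℕ+ => ((n : ℕ) : ℝ) ^ (-r) * lcmRatioProb k n) (lcmMomentConst r k) ∧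
    -- the expectations are averages over the tuples
    (∀ x : ℕ, 2 ≤ x →
      ∫ n, (tupleLcm n : ℝ) ^ r / (x : ℝ) ^ ((k : ℝ) * r) ∂(uniformTupleLaw k x) =
          1 / (x : ℝ) ^ k * ∑ n ∈ boxTuples k x, ((tupleLcm n : ℝ) / (x : ℝ) ^ k) ^ r ∧
      ∫ n, (tupleLcm n : ℝ) ^ r / (∏ i, (n i : ℝ)) ^ r ∂(uniformTupleLaw k x) =
          1 / (x : ℝ) ^ k * ∑ n ∈ boxTuples k x, ((tupleLcm n : ℝ) / ∏ i, (n i : ℝ)) ^ r) ∧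
    -- the asymptotic formulas, with an implied constant that depends on `k` and `r` only
    ∃ K : ℝ, ∀ x : ℕ, 2 ≤ x →
      |(1 / (x : ℝ) ^ k * ∑ n ∈ boxTuples k x, ((tupleLcm n : ℝ) / (x : ℝ) ^ k) ^ r)
          - lcmMomentConst r k / (r + 1) ^ k| ≤ K * lcmMomentError r k x ∧
      |(1 / (x : ℝ) ^ k * ∑ n ∈ boxTuples k x, ((tupleLcm n : ℝ) / ∏ i, (n i : ℝ)) ^ r)
          - lcmMomentConst r k| ≤ K * lcmMomentError r k x :=
  ⟨hasSum_rpow_mul_lcmRatioProb hr,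
    fun _ hx => ⟨integral_lcm_div_pow r (by omega), integral_lcm_div_prod r (by omega)⟩,
    lcmMoment_asymptotics hk hr⟩
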